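/- Setting. Let $\Sigma$ be a closed connected oriented smooth surface with a smooth orientation-reversing involution $\tau$ whose fixed set $C$ is a non-empty union of $l$ circles, and suppose that the quotient surface $\Sigma'=\Sigma/\tau$ (a compact surface with boundary $C$) is orientable, of genus $h$. Let $\mathbf w\subset C$ consist of exactly one point on each component of $C$. Let $\alpha_1,\dots,\alpha_m$, $m=2h+2(l-1)$, be pairwise disjoint smoothly embedded circles in $\Sigma\smallsetminus\mathbf w$ such that each component of $\Sigma\smallsetminus\bigcup_i\alpha_i$ contains exactly one point of $\mathbf w$; put $\beta_i=\tau(\alpha_i)$, and suppose that all $\alpha_i$ are transverse to all $\beta_j$. (This is a multi-pointed real Heegaard diagram.) Let $M=\mathrm{Sym}^m(\Sigma)$, oriented by the orientation of $\Sigma$, let $\mathbb T_\alpha=\alpha_1\times\dots\times\alpha_m\subset M$, let $M^R$ be the fixed set of the involution of $M$ induced by $\tau$, and let $\widehat M^R\subset M^R$ be the set of configurations that contain no point of $\mathbf w$. Orientations. Orient and order the curves $\alpha_i$; this orients $\mathbb T_\alpha$ (product orientation), and $\beta_i$ is oriented as $\tau(\alpha_i)$. Choose an orientation of $\Sigma'$,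 let $\Sigma^+\subset\Sigma\smallsetminus C$ be the part on which its pull-back agrees with the orientation of $\Sigma$, orient $C$ as the boundary of $\Sigma'$ (outward normal first), and choose an order of the components of $C$. A configuration in $\widehat M^R$ consisting of $m$ distinct points has the form $$\mathbf x=\{z_1,\tau(z_1),\dots,z_k,\tau(z_k),c_1,\dots,c_{m-2k}\},\qquad z_i\in\Sigma^+,\ c_j\in C\smallsetminus\mathbf w,$$ where the $c_j$ are listed according to the order of the components of $C$ and, on each component, in the order in which one meets them when following its orientation from its basepoint to itself. Near $\mathbf x$, $\widehat M^R$ is identified with a neighbourhood of $([z_1],\dots,[z_k],c_1,\dots,c_{m-2k})$ in $(\Sigma')^k\times C^{m-2k}$, and it is given $(-1)^{h+l-k-1}$ times the product orientation. Claim. Let $\mathbf x\in\mathbb T_\alpha\cap\widehat M^R$. Then $\mathbf x$ can be written as above, and there are an involution $\sigma$ of $\{1,\dots,m\}$ and injections $r:\{1,\dots,k\}\to\{1,\dots,m\}$, $s:\{1,\dots,m-2k\}\to\{1,\dots,m\}$ such that the fixed points of $\sigma$ are exactly $s(1),\dots,s(m-2k)$ and $$z_i\in\alpha_{r(i)}\cap\beta_{\sigma(r(i))},\qquad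 c_j\in\alpha_{s(j)}.$$ For all such data, $(r(1),\sigma(r(1)),\dots,r(k),\sigma(r(k)),s(1),\dots,s(m-2k))$ is a permutation of $\{1,\dots,m\}$; let $\epsilon(r,\sigma,s)$ be its sign. Let $\epsilon(z_i)$ be the sign of the intersection at $[z_i]$ of the projections of the oriented curves $\alpha_{r(i)}$ and $\beta_{\sigma(r(i))}$ to the oriented surface $\Sigma'$, and let $\epsilon(c_j)$ be the sign of the intersection of the oriented curves $\alpha_{s(j)}$ and $C$ at $c_j$ in $\Sigma$. Then $\mathbb T_\alpha$ and $\widehat M^R$ meet transversely at $\mathbf x$, and the sign of $\mathbf x$ as an intersection point of $\mathbb T_\alpha$ and $\widehat M^R$ (in this order) in $M$ is $$\epsilon(r,\sigma,s)\cdot\prod_{i=1}^{k}\epsilon(z_i)\cdot\prod_{j=1}^{m-2k}\epsilon(c_j).$$ -/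

import Mathlib

open scoped Manifold ContDiff Topology

noncomputable section

namespace RealHF

open Set Module

/-- The model plane of a surface. -/
abbrev Plane := EuclideanSpace ℝ (Fin 2)

section Surface

variable {S : Type} [TopologicalSpace S] [ChartedSpace Plane S]

/-! ### Curves and orientations on a surface -/

/-- The velocity vector of a curve. -/
def velocity (γ : ℝ → S) (t : ℝ) : TangentSpace (𝓡 2) (γ t) :=
  mfderiv 𝓘(ℝ, ℝ) (𝓡 2) γ t (1 : ℝ)

/-- `γ` is a `1`-periodic parametrization of an oriented smoothly embedded circle. -/
structure IsSmoothCircle (γ : ℝ → S) : Prop where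
  smooth : ContMDiff 𝓘(ℝ, ℝ) (𝓡 2) ∞ γ
  periodic : ∀ t, γ (t + 1) = γ t
  injOn : InjOn γ (Ico 0 1)
  immersion : ∀ t, velocity γ t ≠ 0

/-- A choice of an orientation of each tangent plane. -/
abbrev OrientationField (S : Type) [TopologicalSpace S] [ChartedSpace Plane S] :=
  ∀ p : S, Orientation ℝ (TangentSpace (𝓡 2) p) (Fin 2)

/-- `(u, v)` is a positively oriented basis of the tangent plane at `p`. -/
def PosPair (o : OrientationField S) (p : S) (u v : TangentSpace (𝓡 2) p) : Prop :=
  ∃ b : Basis (Fin 2) ℝ (TangentSpace (𝓡 2) p), b 0 = u ∧ b 1 = v ∧ b.orientation = o p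

/-- The field `o` varies continuously on the set `U`, that is, it is an orientation of the
surface `U` when `U` is open: near each point of `U` it is constant in the chart around that
point. (The tangent plane at `p` is identified with the model plane through the chart at `p`.) -/
def IsOrientationOn (o : OrientationField S) (U : Set S) : Prop :=
  ∀ p ∈ U, ∀ᶠ q in 𝓝 p, ∀ u v : TangentSpace (𝓡 2) q,
    PosPair o q u v ↔
      PosPair o p (mfderiv (𝓡 2) 𝓘(ℝ, Plane) (extChartAt (𝓡 2) p) q u)
        (mfderiv (𝓡 2) 𝓘(ℝ, Plane) (extChartAt (𝓡 2) p) q v)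

open Classical in
/-- The sign of the intersection at `p` of two oriented curves with velocities `u` and `v`
(in this order); it is `0` when they are not transverse. -/
def localSign (o : OrientationField S) (p : S) (u v : TangentSpace (𝓡 2) p) : ℤ :=
  if PosPair o p u v then 1 else if PosPair o p v u then -1 else 0

/-- The quotient of `S` by the orbits of the involution `τ`. -/
def orbitSetoid (τ : S → S) (hτ : ∀ p, τ (τ p) = p) : Setoid S where
  r p q := q = p ∨ q = τ p
  iseqv :=
    { refl := fun _ => Or.inl rfl
      symm := by
        rintro p q (h | h)
        · exact Or.inl h.symm
        · right; rw [h, hτ]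
      trans := by
        rintro p q r (h | h) (h' | h')
        · left; rw [h', h]
        · right; rw [h', h]
        · right; rw [h', h]
        · left; rw [h', h, hτ] }

/-- The first Betti number (with rational coefficients), from singular homology. -/
def firstBetti (X : Type) [TopologicalSpace X] : ℕ :=
  Module.finrank ℚ (((AlgebraicTopology.singularHomologyFunctor (ModuleCat.{0} ℚ) 1).obj
    (ModuleCat.of ℚ ℚ)).obj (TopCat.of X))

/-- A compact connected orientable surface `X` with `l ≥ 1` boundary circles has genus `h`:
`b₁(X) = 2h + l - 1`. -/
def HasGenus (X : Type) [TopologicalSpace X] (l h : ℕ) : Prop :=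
  firstBetti X + 1 = 2 * h + l

end Surface

/-! ### Real Heegaard diagrams with oriented quotient -/

/-- A multi-pointed real Heegaard diagram on the surface `S`, with involution `τ`, with orientable
quotient surface `Σ' = S/τ`, with exactly one basepoint on each component of the fixed set `C`,
and with all the auxiliary choices that fix orientations: an orientation of `Σ'`, an order of
the components of `C`, an order and orientations of the alpha curves.

`m` is the number of alpha curves, `l` is the number of components of `C`, `h` is the genus of
the quotient. -/
structure Diagram (S : Type) [TopologicalSpace S] [ChartedSpace Plane S] (m l h : ℕ) where
  /-- the orientation of the surface -/
  o : OrientationField S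
  o_orientation : IsOrientationOn o univ
  /-- the involution, smooth and orientation reversing -/
  τ : S → S
  τ_smooth : ContMDiff (𝓡 2) (𝓡 2) ∞ τ
  τ_invol : ∀ p, τ (τ p) = p
  τ_reversing : ∀ (p : S) (u v : TangentSpace (𝓡 2) p), PosPair o p u v →
    PosPair o (τ p) (mfderiv (𝓡 2) (𝓡 2) τ p v) (mfderiv (𝓡 2) (𝓡 2) τ p u)
  /-- the orientation of `Σ' = (S \ C)/τ`, pulled back to `S \ C`: an orientation of `S \ C`
  preserved by `τ` (its values on `C` are irrelevant) -/
  oQuot : OrientationField S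
  oQuot_orientation : IsOrientationOn oQuot {p | τ p ≠ p}
  oQuot_invariant : ∀ p, τ p ≠ p → ∀ u v : TangentSpace (𝓡 2) p, PosPair oQuot p u v →
    PosPair oQuot (τ p) (mfderiv (𝓡 2) (𝓡 2) τ p u) (mfderiv (𝓡 2) (𝓡 2) τ p v)
  /-- the components of the fixed set `C`, in the chosen order; the one with index `i` is
  parametrized starting from its basepoint `fix i 0` -/
  fix : Fin l → ℝ → S
  fix_circle : ∀ i, IsSmoothCircle (fix i)
  fix_disjoint : ∀ i j, i ≠ j → Disjoint (range (fix i)) (range (fix j))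
  fix_union : {p | τ p = p} = ⋃ i, range (fix i)
  /-- the fixed set is not empty -/
  fix_nonempty : 0 < l
  /-- The circles are parametrized in the direction of the boundary orientation of `C = ∂Σ'`
  (outward normal first). Here `Σ'` is identified with the closure of the part `Σ⁺` of `S \ C`
  on which the orientations of `S` and `Σ'` agree, and an outward normal vector is the velocity
  of a curve that arrives from `Σ⁺`, and that is transverse to `C`. -/
  fix_boundary : ∀ i t, ∃ δ : ℝ → S, ContMDiff 𝓘(ℝ, ℝ) (𝓡 2) ∞ δ ∧ δ 0 = fix i t ∧
    (∀ᶠ s in 𝓝[<] (0 : ℝ), τ (δ s) ≠ δ s ∧ oQuot (δ s) = o (δ s)) ∧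
    PosPair o (fix i t) (velocity δ 0) (velocity (fix i) t)
  /-- the genus of the quotient surface -/
  genus : HasGenus (Quotient (orbitSetoid τ τ_invol)) l h
  /-- The number of alpha curves is `g + l - 1`, where `g = 2h + l - 1` is the genus of the
  double `S` of `Σ'`. -/
  card_alpha : m = 2 * h + 2 * (l - 1)
  /-- the alpha curves, oriented and ordered -/
  α : Fin m → ℝ → S
  α_circle : ∀ i, IsSmoothCircle (α i)
  α_disjoint : ∀ i j, i ≠ j → Disjoint (range (α i)) (range (α j))
  /-- no basepoint lies on an alpha curve -/
  base_notMem : ∀ i j, fix i 0 ∉ range (α j)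
  /-- each component of the complement of the alpha curves contains exactly one basepoint -/
  base_unique : ∀ p ∈ (⋃ j, range (α j))ᶜ,
    ∃! i, fix i 0 ∈ connectedComponentIn (⋃ j, range (α j))ᶜ p
  /-- the alpha curves are transverse to the beta curves `τ ∘ α j` -/
  α_transverse : ∀ i j s t, τ (α j t) = α i s →
    LinearIndependent ℝ ![velocity (α i) s,
      (velocity (fun t => τ (α j t)) t : TangentSpace (𝓡 2) (τ (α j t)))]

namespace Diagram

variable {S : Type} [TopologicalSpace S] [ChartedSpace Plane S] {m l h : ℕ}

/-- The oriented beta curve `β_j = τ(α_j)`. -/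
def β (D : Diagram S m l h) (j : Fin m) (t : ℝ) : S := D.τ (D.α j t)

/-- The part `Σ⁺` of `S \ C` on which the orientation of `Σ'` agrees with that of `S`. -/
def plusPart (D : Diagram S m l h) : Set S := {p | D.τ p ≠ p ∧ D.oQuot p = D.o p}

/-! ### The symmetric product, the torus, and the fixed locus -/

/-- The torus `T_α = α_1 × ⋯ × α_m` in `Sym^m(S)`. -/
def torus (D : Diagram S m l h) : Set (Sym S m) :=
  {x | ∃ t : Fin m → ℝ, (x : Multiset S) = Finset.univ.val.map fun i => D.α i (t i)}

/-- The fixed locus of the involution induced by `τ` on `Sym^m(S)`, punctured: configurations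
that contain a basepoint are removed. -/
def puncturedFixedLocus (D : Diagram S m l h) : Set (Sym S m) :=
  {x | x.map D.τ = x ∧ ∀ i, D.fix i 0 ∉ x}

end Diagram

section Tangent

variable {S : Type} [TopologicalSpace S] [ChartedSpace Plane S] {m l h : ℕ}

/-- The tangent space of `Sym^m(S)` at a configuration `x` of `m` distinct points: the direct sum
of the tangent planes of `S` at the points of `x`. (Near such an `x` the projection
`S^m → Sym^m(S)` is a local diffeomorphism.) -/
abbrev SymTangent (x : Sym S m) : Type := ∀ p : {p : S // p ∈ x}, TangentSpace (𝓡 2) p.1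

open Classical in
/-- The tangent vector to `Sym^m(S)` at `x` that moves only the point `p`, with velocity `v`. -/
def vecAt (x : Sym S m) (p : S) (v : TangentSpace (𝓡 2) p) : SymTangent x :=
  fun q => if q.1 = p then (v : Plane) else (0 : Plane)

/-- The basis of `T_x Sym^m(S)` that lists the bases `E p` of the tangent planes at the points
`p` of `x`, one after the other, in the order given by `e`. -/
def symBasis (x : Sym S m) (e : Fin m ≃ {p : S // p ∈ x})
    (E : ∀ p : {p : S // p ∈ x}, Basis (Fin 2) ℝ (TangentSpace (𝓡 2) p.1)) :
    Basis (Fin (m + m)) ℝ (SymTangent x) :=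
  haveI : Fintype {p : S // p ∈ x} := Fintype.ofEquiv _ e
  (Pi.basis E).reindex <|
    (Equiv.sigmaEquivProd _ _).trans <| (Equiv.prodCongr e.symm (Equiv.refl _)).trans <|
      finProdFinEquiv.trans (finCongr (Nat.mul_two m))

end Tangent

namespace Diagram

variable {S : Type} [TopologicalSpace S] [ChartedSpace Plane S] {m l h : ℕ}

/-- The tangent space of `T_α` at `x`: each point of `x` moves along its alpha curve. -/
def torusTangent (D : Diagram S m l h) (x : Sym S m) : Submodule ℝ (SymTangent x) where
  carrier := {v | ∀ i t, ∀ hp : D.α i t ∈ x,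
    v ⟨D.α i t, hp⟩ ∈ Submodule.span ℝ {velocity (D.α i) t}}
  add_mem' := fun ha hb i t hp => Submodule.add_mem _ (ha i t hp) (hb i t hp)
  zero_mem' := fun _ _ _ => Submodule.zero_mem _
  smul_mem' := fun c _ ha i t hp => Submodule.smul_mem _ c (ha i t hp)

/-- The tangent space of the fixed locus at `x`: the tangent vectors fixed by the differential of
the involution. -/
def fixedTangent (D : Diagram S m l h) (x : Sym S m) : Submodule ℝ (SymTangent x) where
  carrier := {v | ∀ p : {p : S // p ∈ x}, ∀ hp : D.τ p.1 ∈ x,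
    v ⟨D.τ p.1, hp⟩ = mfderiv (𝓡 2) (𝓡 2) D.τ p.1 (v p)}
  add_mem' := fun {a b} ha hb p hp => by
    change a _ + b _ = mfderiv (𝓡 2) (𝓡 2) D.τ p.1 (a p + b p)
    rw [ha p hp, hb p hp, map_add]
  zero_mem' := fun p hp => by
    change 0 = mfderiv (𝓡 2) (𝓡 2) D.τ p.1 0
    rw [map_zero]
  smul_mem' := fun c a ha p hp => by
    change c • a _ = mfderiv (𝓡 2) (𝓡 2) D.τ p.1 (c • a p)
    rw [ha p hp, map_smul]

/-! ### Orientations -/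

/-- Positive bases of `T_x Sym^m(S)`, for the orientation induced by that of `S`. -/
def IsPosSym (D : Diagram S m l h) (x : Sym S m)
    (b : Basis (Fin (m + m)) ℝ (SymTangent x)) : Prop :=
  ∃ (e : Fin m ≃ {p : S // p ∈ x})
    (E : ∀ p : {p : S // p ∈ x}, Basis (Fin 2) ℝ (TangentSpace (𝓡 2) p.1)),
    (∀ p, (E p).orientation = D.o p.1) ∧ b.orientation = (symBasis x e E).orientation

/-- Positive bases of `T_x T_α`, for the product orientation of `α_1 × ⋯ × α_m`. -/
def IsPosTorus (D : Diagram S m l h) (x : Sym S m)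
    (b : Basis (Fin m) ℝ (D.torusTangent x)) : Prop :=
  ∃ b₀ : Basis (Fin m) ℝ (D.torusTangent x),
    (∀ i, ∃ t, D.α i t ∈ x ∧ (b₀ i : SymTangent x) = vecAt x (D.α i t) (velocity (D.α i) t)) ∧
    b.orientation = b₀.orientation

/-- A presentation of the configuration `x` as a point of the stratum
`Sym^k(Σ') × Sym^n(C \ w)` of the punctured fixed locus:
`x = {z_1, τ(z_1), …, z_k, τ(z_k), c_1, …, c_n}`, with `z_i ∈ Σ⁺` and with distinct points `c_j`
of `C \ w` listed in the order of the components of `C`, and on each component in the order in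
which they appear when it is traversed from its basepoint to itself.
The point `c_j` is `fix (comp j) (par j)`. -/
structure StratumPoint (D : Diagram S m l h) (x : Sym S m) (k n : ℕ) where
  card_eq : k * 2 + n = m
  z : Fin k → S
  comp : Fin n → Fin l
  par : Fin n → ℝ
  z_mem : ∀ i, z i ∈ D.plusPart
  par_mem : ∀ j, par j ∈ Ioo (0 : ℝ) 1
  ordered : StrictMono fun j => toLex (comp j, par j)
  eq : (x : Multiset S) = Finset.univ.val.map z + (Finset.univ.val.map fun i => D.τ (z i)) +
    Finset.univ.val.map fun j => D.fix (comp j) (par j)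

/-- The list of tangent vectors to the fixed locus at `x` that corresponds to
`T_{z_1}Σ' ⊕ ⋯ ⊕ T_{z_k}Σ' ⊕ T_{c_1}C ⊕ ⋯ ⊕ T_{c_n}C`: first the vectors of the bases `E i` of
`T_{z_i}Σ'`, a vector `v` of `T_{z_i}Σ'` moving `z_i` with velocity `v` and `τ(z_i)` with velocity
`dτ(v)`; then the velocities of `C` at the points `c_j`. -/
def StratumPoint.frame {D : Diagram S m l h} {x : Sym S m} {k n : ℕ} (P : D.StratumPoint x k n)
    (E : ∀ i, Basis (Fin 2) ℝ (TangentSpace (𝓡 2) (P.z i))) : Fin m → SymTangent x :=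
  fun a => Fin.append
    (fun q : Fin (k * 2) =>
      let i := (finProdFinEquiv.symm q).1
      let v := E i (finProdFinEquiv.symm q).2
      vecAt x (P.z i) v + vecAt x (D.τ (P.z i)) (mfderiv (𝓡 2) (𝓡 2) D.τ (P.z i) v))
    (fun j : Fin n =>
      vecAt x (D.fix (P.comp j) (P.par j)) (velocity (D.fix (P.comp j)) (P.par j)))
    (Fin.cast P.card_eq.symm a)

/-- Positive bases of the tangent space at `x` of the oriented punctured fixed locus: on the
stratum `Sym^k(Σ') × Sym^n(C \ w)`, the orientation is `(-1)^(h+l-k-1)` times the product of the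
orientation of `Sym^k(Σ')` induced by that of `Σ'` and of the orientation of `Sym^n(C \ w)` given
by the order and the orientation of the components of `C`. -/
def IsPosFixed (D : Diagram S m l h) (x : Sym S m)
    (b : Basis (Fin m) ℝ (D.fixedTangent x)) : Prop :=
  ∃ (k n : ℕ) (P : D.StratumPoint x k n)
    (E : ∀ i, Basis (Fin 2) ℝ (TangentSpace (𝓡 2) (P.z i)))
    (b₀ : Basis (Fin m) ℝ (D.fixedTangent x)),
    (∀ i, (E i).orientation = D.oQuot (P.z i)) ∧
    (∀ a, (b₀ a : SymTangent x) = P.frame E a) ∧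
    b.orientation = Int.negOnePow ((h : ℤ) + l - k - 1) • b₀.orientation

/-- `T_α` and the punctured fixed locus meet transversely at `x`, with sign `s = ±1`:
`T_x T_α` and the tangent space of the fixed locus are complementary in `T_x Sym^m(S)`, and a
positive basis of the first followed by a positive basis of the second is a positive basis of
`T_x Sym^m(S)` if `s = 1`, and a negative one if `s = -1`. -/
def HasIntersectionSign (D : Diagram S m l h) (x : Sym S m) (s : ℤ) : Prop :=
  IsCompl (D.torusTangent x) (D.fixedTangent x) ∧
  (∃ u, D.IsPosTorus x u) ∧ (∃ v, D.IsPosFixed x v) ∧ (∃ w, D.IsPosSym x w) ∧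
  ∀ (u : Basis (Fin m) ℝ (D.torusTangent x)) (v : Basis (Fin m) ℝ (D.fixedTangent x))
    (w b : Basis (Fin (m + m)) ℝ (SymTangent x)),
    D.IsPosTorus x u → D.IsPosFixed x v → D.IsPosSym x w →
    (∀ a, b a = Fin.append (fun i => (u i : SymTangent x)) (fun i => (v i : SymTangent x)) a) →
    (s = 1 ∧ b.orientation = w.orientation) ∨ (s = -1 ∧ b.orientation = -w.orientation)

/-! ### The combinatorial data of an invariant intersection point -/

/-- The combinatorial data of a point `x = {z_1, τ(z_1), …, z_k, τ(z_k), c_1, …, c_n}` of the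
intersection of `T_α` and the fixed locus: `z_i ∈ α_{r(i)} ∩ β_{σ(r(i))}`, `c_j ∈ α_{s(j)}`, where
`σ` is an involution of the index set with fixed points `s(1), …, s(n)` and with `2`-cycles
`(r(i), σ(r(i)))`. The parameters of these points on the alpha and beta curves are recorded. -/
structure Labelling {D : Diagram S m l h} {x : Sym S m} {k n : ℕ} (P : D.StratumPoint x k n) where
  σ : Equiv.Perm (Fin m)
  r : Fin k → Fin m
  s : Fin n → Fin m
  σ_invol : ∀ i, σ (σ i) = i
  σ_fixed : ∀ i, σ i = i ↔ i ∈ range s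
  r_injective : Function.Injective r
  s_injective : Function.Injective s
  tα : Fin k → ℝ
  tβ : Fin k → ℝ
  tc : Fin n → ℝ
  z_mem_α : ∀ i, D.α (r i) (tα i) = P.z i
  z_mem_β : ∀ i, D.β (σ (r i)) (tβ i) = P.z i
  c_mem_α : ∀ j, D.α (s j) (tc j) = D.fix (P.comp j) (P.par j)

namespace Labelling

variable {D : Diagram S m l h} {x : Sym S m} {k n : ℕ} {P : D.StratumPoint x k n}

/-- The list `(r(1), σ(r(1)), …, r(k), σ(r(k)), s(1), …, s(n))`. -/
def list (L : Labelling P) : Fin m → Fin m :=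
  fun a => Fin.append
    (fun q : Fin (k * 2) =>
      if (finProdFinEquiv.symm q).2 = 0 then L.r (finProdFinEquiv.symm q).1
      else L.σ (L.r (finProdFinEquiv.symm q).1))
    L.s (Fin.cast P.card_eq.symm a)

/-- The sign `ε(z_i)` of the intersection of the projections of `α_{r(i)}` and `β_{σ(r(i))}` to
`Σ'` at the image of `z_i`. -/
def signZ (L : Labelling P) (i : Fin k) : ℤ :=
  localSign D.oQuot (P.z i) (velocity (D.α (L.r i)) (L.tα i))
    (velocity (D.β (L.σ (L.r i))) (L.tβ i))

/-- The sign `ε(c_j)` of the intersection of `α_{s(j)}` and `C` in `S` at `c_j`. -/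
def signC (L : Labelling P) (j : Fin n) : ℤ :=
  localSign D.o (D.fix (P.comp j) (P.par j)) (velocity (D.α (L.s j)) (L.tc j))
    (velocity (D.fix (P.comp j)) (P.par j))

end Labelling

end Diagram

end RealHF

end

open scoped Manifold ContDiff Topology

noncomputable section

namespace RealHF

open Set Module

/-! The proof compares determinants in bases adapted to the intersection point. At each point of `x`
take a basis of the tangent plane whose first vector is the velocity of the alpha curve through it:
$(\alpha_{r(i)}',\beta_{\sigma(r(i))}')$ at $z_i$, $(\alpha_{\sigma(r(i))}',\beta_{r(i)}')$ at
$\tau(z_i)$, $(\alpha_{s(j)}',C')$ at $c_j$. Transversality of the alpha and beta curves makes these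
bases; at $c_j$ it does so because $d\tau$ fixes $C'$. Since $\beta=\tau(\alpha)$, $d\tau$ carries
the basis at $z_i$ to the one at $\tau(z_i)$ with its two vectors exchanged. As $\tau$ reverses
orientation, the local signs at $z_i$ and $\tau(z_i)$ coincide and cancel in the product; only the
$\epsilon(c_j)$ survive (`prod_localSign`).

Listing all first vectors before all second ones costs $(-1)^p$, where $m=2p$ and $p=h+l-1$
(`sign_shuffle`). In this order the torus frame is the first half of the basis, so only the $m\times
m$ matrix of second coordinates of the fixed frame matters (`splitBasis_det`). After permuting its
rows by the list $(r(1),\sigma(r(1)),\dots,s(1),\dots)$ it is block diagonal: a block $1$ for each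
$c_j$ and, for each $z_i$, a $2\times2$ block with exchanged rows and determinant of sign
$-\epsilon(z_i)$ (`det_frame`). This gives $\epsilon(r,\sigma,s)(-1)^k\prod\epsilon(z_i)$. The
orientation convention adds $(-1)^{p-k}$, and $(-1)^p(-1)^k(-1)^{p-k}=1$.

The same determinant is nonzero, which yields transversality. Another presentation of `x` only
permutes the $z_i$, which moves entries of the list in pairs and changes no sign
(`exists_transfer`). -/

/-- `s = ±1` is the sign of the nonzero real number `r`. -/
def HasSign (r : ℝ) (s : ℤ) : Prop := (s = 1 ∧ 0 < r) ∨ (s = -1 ∧ r < 0)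

namespace HasSign

theorem one_iff {r : ℝ} : HasSign r 1 ↔ 0 < r := by simp [HasSign]

theorem neg_one_iff {r : ℝ} : HasSign r (-1) ↔ r < 0 := by simp [HasSign]

theorem mul {r r' : ℝ} {s s' : ℤ} (h : HasSign r s) (h' : HasSign r' s') :
    HasSign (r * r') (s * s') := by
  rcases h with ⟨rfl, h⟩ | ⟨rfl, h⟩ <;> rcases h' with ⟨rfl, h'⟩ | ⟨rfl, h'⟩
  · exact Or.inl ⟨rfl, mul_pos h h'⟩
  · exact Or.inr ⟨rfl, mul_neg_of_pos_of_neg h h'⟩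
  · exact Or.inr ⟨rfl, mul_neg_of_neg_of_pos h h'⟩
  · exact Or.inl ⟨rfl, mul_pos_of_neg_of_neg h h'⟩

theorem neg {r : ℝ} {s : ℤ} (h : HasSign r s) : HasSign (-r) (-s) := by
  simpa using (neg_one_iff.2 (by norm_num : (-1 : ℝ) < 0)).mul h

theorem mul_self {r : ℝ} {s : ℤ} (h : HasSign r s) : s * s = 1 := by
  rcases h with ⟨rfl, -⟩ | ⟨rfl, -⟩ <;> rfl

theorem prod {ι : Type*} [Fintype ι] {r : ι → ℝ} {s : ι → ℤ} (h : ∀ i, HasSign (r i) (s i)) :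
    HasSign (∏ i, r i) (∏ i, s i) := by
  classical
  induction (Finset.univ : Finset ι) using Finset.induction_on with
  | empty => simpa using one_iff.2 one_pos
  | insert a t ha ih => rw [Finset.prod_insert ha, Finset.prod_insert ha]; exact (h a).mul ih

theorem units (u : ℤˣ) : HasSign ((u : ℤ) : ℝ) u := by
  rcases Int.units_eq_one_or u with rfl | rfl <;> simp [HasSign]

end HasSign

/-! ### Orientations as signs of determinants, and the sign of the shuffle. -/

section Det

variable {ι κ : Type*} [Fintype ι] [DecidableEq ι] [Fintype κ] [DecidableEq κ]
  {V : Type*} [AddCommGroup V] [Module ℝ V]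

theorem orientation_smul_eq_of_hasSign {w b : Basis ι ℝ V} {s : ℤ} (h : HasSign (w.det b) s) :
    (s = 1 ∧ b.orientation = w.orientation) ∨ (s = -1 ∧ b.orientation = -w.orientation) := by
  rcases h with ⟨hs, h⟩ | ⟨hs, h⟩
  · exact Or.inl ⟨hs, ((Basis.orientation_eq_iff_det_pos w b).2 h).symm⟩
  · refine Or.inr ⟨hs, ?_⟩
    rcases w.orientation_eq_or_eq_neg b.orientation with h' | h'
    · exact absurd ((Basis.orientation_eq_iff_det_pos w b).1 h'.symm) h.not_gt
    · exact h'

theorem hasSign_det_of_orientation {w b : Basis ι ℝ V} (u : ℤˣ)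
    (h : b.orientation = u • w.orientation) : HasSign (w.det b) u := by
  rcases Int.units_eq_one_or u with rfl | rfl
  · rw [one_smul] at h
    exact HasSign.one_iff.2 ((Basis.orientation_eq_iff_det_pos w b).1 h.symm)
  · have h' : b.orientation = -w.orientation := by
      rw [h]
      induction w.orientation using Module.Ray.ind with
      | h v hv => rw [smul_rayOfNeZero, neg_rayOfNeZero]; congr 1; simp [Units.smul_def]
    refine HasSign.neg_one_iff.2 ?_
    have hne : w.det b ≠ 0 := (w.isUnit_det b).ne_zero
    refine hne.lt_of_le (not_lt.1 fun hp => ?_)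
    have := (Basis.orientation_eq_iff_det_pos w b).2 hp
    rw [h'] at this
    exact Module.Ray.ne_neg_self _ this

theorem det_prod_prod {U W : Type*} [AddCommGroup U] [Module ℝ U] [AddCommGroup W] [Module ℝ W]
    (u u' : Basis ι ℝ U) (v v' : Basis κ ℝ W) :
    (u.prod v).det (u'.prod v') = u.det u' * v.det v' := by
  rw [Basis.det_apply, Basis.det_apply, Basis.det_apply,
    ← Matrix.det_fromBlocks_zero₂₁ _ (0 : Matrix ι κ ℝ)]
  congr 1
  ext (i | i) (j | j) <;> simp [Basis.toMatrix_apply]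

/-- The list `(1,0), (2,0), …, (1,1), (2,1), …` of the pairs `(i,c)`. -/
def sumEquivPair (m : ℕ) : Fin m ⊕ Fin m ≃ Fin m × Fin 2 where
  toFun := Sum.elim (fun i => (i, 0)) (fun i => (i, 1))
  invFun q := if q.2 = 0 then Sum.inl q.1 else Sum.inr q.1
  left_inv := by rintro (i | i) <;> simp
  right_inv := by
    rintro ⟨i, c⟩
    fin_cases c <;> simp

/-- The comparison of the orders `(1,0), (2,0), …, (1,1), (2,1), …` and
`(1,0), (1,1), (2,0), (2,1), …`. -/
def shuffle (m : ℕ) : Equiv.Perm (Fin (m + m)) :=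
  finSumFinEquiv.symm.trans ((sumEquivPair m).trans
    (finProdFinEquiv.trans (finCongr (Nat.mul_two m))))

theorem shuffle_castAdd {m : ℕ} (i : Fin m) :
    ((shuffle m (Fin.castAdd m i) : Fin (m + m)) : ℕ) = 2 * i := by
  simp [shuffle, sumEquivPair]

theorem shuffle_natAdd {m : ℕ} (i : Fin m) :
    ((shuffle m (Fin.natAdd m i) : Fin (m + m)) : ℕ) = 2 * i + 1 := by
  have : finSumFinEquiv.symm (Fin.natAdd m i) = (Sum.inr i : Fin m ⊕ Fin m) :=
    finSumFinEquiv_symm_apply_natAdd i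
  simp only [shuffle, Equiv.trans_apply, this]
  simp [sumEquivPair]
  ring

/-- Inversions occur only between the two halves: the `i`-th first vector and the `j`-th second
vector are inverted exactly when `j < i`. Their number is $m(m-1)/2=p(2p-1)$, which has the parity
of $p$. -/
theorem sign_shuffle {m p : ℕ} (hm : m = 2 * p) : Equiv.Perm.sign (shuffle m) = (-1) ^ p := by
  have h1 : Equiv.Perm.sign (shuffle m) =
      ∏ a, ∏ b, if a < b then (if shuffle m a < shuffle m b then (1 : ℤˣ) else -1) else 1 := by
    rw [Equiv.Perm.sign_eq_prod_prod_Ioi]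
    refine Finset.prod_congr rfl fun a _ => ?_
    rw [← Finset.prod_filter]
    refine Finset.prod_congr ?_ fun _ _ => rfl
    ext; simp
  -- The `i`-th first vector takes part in exactly `i` inversions.
  have h2 : ∀ i : Fin m, (∏ j : Fin m, if i ≤ j then (1 : ℤˣ) else -1) = (-1) ^ (i : ℕ) := by
    intro i
    have : ∀ j : Fin m, (if i ≤ j then (1 : ℤˣ) else -1) = if j < i then -1 else 1 := by
      intro j
      by_cases h : i ≤ j
      · rw [if_pos h, if_neg h.not_gt]
      · rw [if_neg h, if_pos (not_le.1 h)]
    simp_rw [this]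
    rw [← Finset.prod_filter, Finset.prod_const]
    congr 1
    have : Finset.univ.filter (fun j => j < i) = Finset.Iio i := by ext; simp
    rw [this, Fin.card_Iio]
  have h3 : ∀ p : ℕ, ∏ i ∈ Finset.range (2 * p), (-1 : ℤˣ) ^ i = (-1) ^ p := by
    intro p
    induction p with
    | zero => simp
    | succ p ih =>
      rw [Nat.mul_succ, Finset.prod_range_succ, Finset.prod_range_succ, ih, pow_succ, pow_succ,
        pow_mul]
      simp
  rw [h1, Fin.prod_univ_add]
  simp only [Fin.prod_univ_add, Fin.lt_def, shuffle_castAdd, shuffle_natAdd, Fin.val_castAdd,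
    Fin.val_natAdd]
  have e1 : ∀ i j : Fin m, (if (i : ℕ) < j then (if 2 * (i : ℕ) < 2 * j then (1 : ℤˣ) else -1)
      else 1) = 1 := by
    intro i j; split_ifs <;> first | rfl | omega
  have e2 : ∀ i j : Fin m, (if (i : ℕ) < m + j then (if 2 * (i : ℕ) < 2 * j + 1 then (1 : ℤˣ)
      else -1) else 1) = if i ≤ j then 1 else -1 := by
    intro i j
    have := i.isLt
    rw [if_pos (by omega)]
    congr 1
    rw [Fin.le_def]
    exact propext (by omega)
  have e3 : ∀ i j : Fin m, (if m + (i : ℕ) < j then (if 2 * (i : ℕ) + 1 < 2 * j then (1 : ℤˣ)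
      else -1) else 1) = 1 := by
    intro i j
    have := j.isLt
    rw [if_neg (by omega)]
  have e4 : ∀ i j : Fin m, (if m + (i : ℕ) < m + j then (if 2 * (i : ℕ) + 1 < 2 * j + 1 then
      (1 : ℤˣ) else -1) else 1) = 1 := by
    intro i j; split_ifs <;> first | rfl | omega
  simp only [e1, e2, e3, e4, Finset.prod_const_one, one_mul, mul_one, h2]
  rw [Fin.prod_univ_eq_prod_range (fun i => (-1 : ℤˣ) ^ i) m, hm, h3]

end Det

/-! ### Bases of the tangent space of the symmetric product. -/

section SymBasis

variable {S : Type} [TopologicalSpace S] [ChartedSpace Plane S] {m l h : ℕ}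

theorem vecAt_self (x : Sym S m) (p : {p : S // p ∈ x}) (v : TangentSpace (𝓡 2) p.1) :
    vecAt x p.1 v p = v := by
  simp [vecAt]

theorem vecAt_of_ne (x : Sym S m) (q : S) (p : {p : S // p ∈ x}) (h : p.1 ≠ q)
    (v : TangentSpace (𝓡 2) q) : vecAt x q v p = 0 := by
  exact if_neg h

/-- The enumeration of the pairs `(i,c)` used by `symBasis`. -/
def pairIndex (m : ℕ) : Fin m × Fin 2 ≃ Fin (m + m) :=
  finProdFinEquiv.trans (finCongr (Nat.mul_two m))

variable (x : Sym S m) (e : Fin m ≃ {p : S // p ∈ x})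
    (E F : ∀ p : {p : S // p ∈ x}, Basis (Fin 2) ℝ (TangentSpace (𝓡 2) p.1))

theorem symBasis_repr (v : SymTangent x) (i : Fin m) (c : Fin 2) :
    (symBasis x e E).repr v (pairIndex m (i, c)) = (E (e i)).repr (v (e i)) c := by
  let _ : Fintype {p : S // p ∈ x} := Fintype.ofEquiv _ e
  rw [symBasis, Basis.repr_reindex_apply]
  have : ((Equiv.sigmaEquivProd _ _).trans <| (Equiv.prodCongr e.symm (Equiv.refl _)).trans <|
      finProdFinEquiv.trans (finCongr (Nat.mul_two m))).symm (pairIndex m (i, c)) =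
      (⟨e i, c⟩ : Σ _ : {p : S // p ∈ x}, Fin 2) := by
    rw [Equiv.symm_apply_eq]
    simp [pairIndex]
  rw [this, Pi.basis_repr]

theorem symBasis_apply (i : Fin m) (c : Fin 2) :
    symBasis x e E (pairIndex m (i, c)) = vecAt x (e i).1 (E (e i) c) := by
  refine (symBasis x e E).repr.injective (Finsupp.ext fun q => ?_)
  obtain ⟨⟨j, d⟩, rfl⟩ := (pairIndex m).surjective q
  rw [symBasis_repr (x := x) (v := vecAt x _ _), Basis.repr_self]
  by_cases hij : i = j
  · subst hij
    rw [vecAt_self, Basis.repr_self]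
    simp [Finsupp.single_apply]
  · rw [vecAt_of_ne, map_zero]
    · simp [hij]
    · exact fun h => hij (e.injective (Subtype.ext h)).symm

/-- Vectors at distinct points do not interact, so the change of basis is block diagonal with one
block per point. -/
theorem symBasis_det_symBasis :
    (symBasis x e E).det (symBasis x e F) = ∏ i, (E (e i)).det (F (e i)) := by
  rw [Basis.det_apply, ← Matrix.det_submatrix_equiv_self ((Equiv.prodComm _ _).trans (pairIndex m))]
  simp only [Basis.det_apply]
  rw [← Matrix.det_blockDiagonal]
  congr 1
  ext ⟨c, i⟩ ⟨d, j⟩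
  simp only [Matrix.submatrix_apply, Equiv.trans_apply, Equiv.prodComm_apply, Prod.swap_prod_mk,
    Basis.toMatrix_apply, symBasis_repr, symBasis_apply, Matrix.blockDiagonal_apply]
  split_ifs with hij
  · subst hij; rw [vecAt_self]
  · rw [vecAt_of_ne, map_zero]
    · rfl
    · exact fun h => hij (e.injective (Subtype.ext h))

/-- A renumbering of the points acts by the same permutation on the first and on the second vectors,
so its sign is a square. Hence the orientation of the symmetric product is independent of the
numbering. -/
theorem symBasis_det_reorder (e' : Fin m ≃ {p : S // p ∈ x}) :
    (symBasis x e E).det (symBasis x e' E) = 1 := by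
  let σ : Equiv.Perm (Fin m) := e'.trans e.symm
  let ρ : Equiv.Perm (Fin (m + m)) :=
    (pairIndex m).permCongr ((Equiv.prodComm _ _).permCongr (Equiv.prodCongrRight fun _ : Fin 2 => σ))
  have h : ⇑(symBasis x e' E) = symBasis x e E ∘ ρ := by
    funext q
    obtain ⟨⟨i, c⟩, rfl⟩ := (pairIndex m).surjective q
    have : ρ (pairIndex m (i, c)) = pairIndex m (σ i, c) := by
      simp [ρ, Equiv.permCongr_apply]
    rw [Function.comp_apply, this, symBasis_apply, symBasis_apply,
      show e (σ i) = e' i by simp [σ]]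
  rw [h, AlternatingMap.map_perm, Basis.det_self]
  have : Equiv.Perm.sign ρ = 1 := by
    rw [Equiv.Perm.sign_permCongr, Equiv.Perm.sign_permCongr, Equiv.Perm.sign_prodCongrRight]
    simp
  rw [this, one_smul]

/-- The basis of the tangent space of the symmetric product that lists first the first vectors, and
then the second vectors, of the bases `F p` of the tangent planes. -/
def splitBasis : Basis (Fin (m + m)) ℝ (SymTangent x) := (symBasis x e F).reindex (shuffle m).symm

theorem shuffle_castAdd_eq (i : Fin m) : shuffle m (Fin.castAdd m i) = pairIndex m (i, 0) := by
  ext; rw [shuffle_castAdd]; simp [pairIndex]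

theorem shuffle_natAdd_eq (i : Fin m) : shuffle m (Fin.natAdd m i) = pairIndex m (i, 1) := by
  ext; rw [shuffle_natAdd]; simp [pairIndex]; ring

theorem splitBasis_castAdd (i : Fin m) :
    splitBasis x e F (Fin.castAdd m i) = vecAt x (e i).1 (F (e i) 0) := by
  rw [splitBasis, Basis.reindex_apply, Equiv.symm_symm, shuffle_castAdd_eq, symBasis_apply]

theorem splitBasis_repr_natAdd (v : SymTangent x) (i : Fin m) :
    (splitBasis x e F).repr v (Fin.natAdd m i) = (F (e i)).repr (v (e i)) 1 := by
  rw [splitBasis, Basis.repr_reindex_apply, Equiv.symm_symm, shuffle_natAdd_eq, symBasis_repr]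

theorem symBasis_det_splitBasis {p : ℕ} (hm : m = 2 * p) :
    (symBasis x e F).det (splitBasis x e F) = (-1) ^ p := by
  have h : ⇑(splitBasis x e F) = symBasis x e F ∘ shuffle m := by
    funext q
    simp [splitBasis]
  rw [h, AlternatingMap.map_perm, Basis.det_self, sign_shuffle hm]
  rcases Nat.even_or_odd p with hp | hp
  · rw [hp.neg_one_pow, hp.neg_one_pow, one_smul]
  · rw [hp.neg_one_pow, hp.neg_one_pow, Units.neg_smul, one_smul]

/-- The first half of `v` is the first half of the basis, so the matrix is block upper triangular
with an identity block. -/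
theorem splitBasis_det (v : Fin (m + m) → SymTangent x)
    (hv : ∀ i, v (Fin.castAdd m i) = vecAt x (e i).1 (F (e i) 0)) :
    (splitBasis x e F).det v =
      (Matrix.of fun i j : Fin m => (F (e i)).repr (v (Fin.natAdd m j) (e i)) 1).det := by
  rw [Basis.det_apply, ← Matrix.det_submatrix_equiv_self finSumFinEquiv]
  have : ((splitBasis x e F).toMatrix v).submatrix finSumFinEquiv finSumFinEquiv =
      Matrix.fromBlocks 1
        (Matrix.of fun i j : Fin m =>
          (splitBasis x e F).repr (v (Fin.natAdd m j)) (Fin.castAdd m i)) 0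
        (Matrix.of fun i j : Fin m => (F (e i)).repr (v (Fin.natAdd m j) (e i)) 1) := by
    have h1 : ∀ j, (splitBasis x e F).repr (v (Fin.castAdd m j)) =
        Finsupp.single (Fin.castAdd m j) 1 := by
      intro j; rw [hv, ← splitBasis_castAdd, Basis.repr_self]
    ext (i | i) (j | j)
    · simp [Basis.toMatrix_apply, h1, Finsupp.single_apply, Matrix.one_apply, eq_comm]
    · simp [Basis.toMatrix_apply]
    · simp only [Matrix.submatrix_apply, finSumFinEquiv_apply_right, finSumFinEquiv_apply_left,
        Basis.toMatrix_apply, h1, Matrix.fromBlocks_apply₂₁, Matrix.zero_apply]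
      rw [Finsupp.single_apply, if_neg]
      intro h
      have := congrArg Fin.val h
      simp at this
      omega
    · simp only [Matrix.submatrix_apply, finSumFinEquiv_apply_right, Basis.toMatrix_apply,
        Matrix.fromBlocks_apply₂₂, Matrix.of_apply, splitBasis_repr_natAdd]
  rw [this, Matrix.det_fromBlocks_zero₂₁, Matrix.det_one, one_mul]

end SymBasis

/-! ### Linear algebra of complementary subspaces and of block matrices. -/

section Complement

variable {V : Type*} [AddCommGroup V] [Module ℝ V] {m : ℕ}

/-- Two independent subspaces that contain the two halves of a basis are complementary, and are
spanned by these halves. -/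
theorem isCompl_of_basis_append {U W : Submodule ℝ V} (hUW : Disjoint U W) {u f : Fin m → V}
    (hu : ∀ i, u i ∈ U) (hf : ∀ i, f i ∈ W) (hli : LinearIndependent ℝ (Fin.append u f))
    (hsp : Submodule.span ℝ (range (Fin.append u f)) = ⊤) :
    IsCompl U W ∧ (∃ b : Basis (Fin m) ℝ U, ∀ i, (b i : V) = u i) ∧
      ∃ b : Basis (Fin m) ℝ W, ∀ i, (b i : V) = f i := by
  have hr : range (Fin.append u f) = range u ∪ range f := by
    ext y
    constructor
    · rintro ⟨i, rfl⟩
      induction i using Fin.addCases with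
      | left i => left; exact ⟨i, by simp⟩
      | right i => right; exact ⟨i, (Fin.append_right _ _ _).symm⟩
    · rintro (⟨i, rfl⟩ | ⟨i, rfl⟩)
      · exact ⟨Fin.castAdd m i, by simp⟩
      · exact ⟨Fin.natAdd m i, Fin.append_right _ _ _⟩
  rw [hr, Submodule.span_union] at hsp
  have hu' : Submodule.span ℝ (range u) ≤ U := Submodule.span_le.2 (range_subset_iff.2 hu)
  have hf' : Submodule.span ℝ (range f) ≤ W := Submodule.span_le.2 (range_subset_iff.2 hf)
  have hUu : Submodule.span ℝ (range u) = U := by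
    refine le_antisymm hu' fun y hy => ?_
    obtain ⟨p, hp, q, hq, rfl⟩ := Submodule.mem_sup.1 (hsp ▸ Submodule.mem_top : y ∈ _)
    have : q = 0 := Submodule.disjoint_def.1 hUW q
      (by simpa using U.sub_mem hy (hu' hp)) (hf' hq)
    simpa [this] using hp
  have hWf : Submodule.span ℝ (range f) = W := by
    refine le_antisymm hf' fun y hy => ?_
    obtain ⟨p, hp, q, hq, rfl⟩ := Submodule.mem_sup.1 (hsp ▸ Submodule.mem_top : y ∈ _)
    have : p = 0 := Submodule.disjoint_def.1 hUW p (hu' hp)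
      (by simpa using W.sub_mem hy (hf' hq))
    simpa [this] using hq
  have hlu : LinearIndependent ℝ u := by
    convert hli.comp (Fin.castAdd m) (Fin.castAdd_injective m m) using 1
    funext i; simp
  have hlf : LinearIndependent ℝ f := by
    convert hli.comp (Fin.natAdd m) (Fin.natAdd_injective m m) using 1
    funext i; exact (Fin.append_right _ _ _).symm
  refine ⟨⟨hUW, codisjoint_iff.2 (top_le_iff.1 (hsp ▸ sup_le_sup hu' hf'))⟩,
    ⟨(Basis.span hlu).map (LinearEquiv.ofEq _ _ hUu), fun i => ?_⟩,
    ⟨(Basis.span hlf).map (LinearEquiv.ofEq _ _ hWf), fun i => ?_⟩⟩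
  · simp [Basis.span_apply]
  · simp [Basis.span_apply]

/-- The basis of a direct sum obtained by juxtaposition of bases of the summands. -/
def appendBasis {U W : Submodule ℝ V} (hUW : IsCompl U W) (u : Basis (Fin m) ℝ U)
    (v : Basis (Fin m) ℝ W) : Basis (Fin (m + m)) ℝ V :=
  ((u.prod v).map (U.prodEquivOfIsCompl W hUW)).reindex finSumFinEquiv

theorem appendBasis_apply {U W : Submodule ℝ V} (hUW : IsCompl U W) (u : Basis (Fin m) ℝ U)
    (v : Basis (Fin m) ℝ W) (a : Fin (m + m)) :
    appendBasis hUW u v a = Fin.append (fun i => (u i : V)) (fun i => (v i : V)) a := by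
  induction a using Fin.addCases with
  | left i => simp [appendBasis]
  | right i =>
    rw [appendBasis, Basis.reindex_apply, finSumFinEquiv_symm_apply_natAdd, Fin.append_right]
    simp

theorem appendBasis_det {U W : Submodule ℝ V} (hUW : IsCompl U W) (u u' : Basis (Fin m) ℝ U)
    (v v' : Basis (Fin m) ℝ W) :
    (appendBasis hUW u v).det (appendBasis hUW u' v') = u.det u' * v.det v' := by
  rw [← det_prod_prod, appendBasis, Basis.det_reindex, Basis.det_map]
  congr 1
  funext i
  simp [appendBasis]

/-- A map that exchanges the vectors of two bases of planes exchanges coordinates. -/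
theorem repr_one_of_swap {A B : Type*} [AddCommGroup A] [Module ℝ A] [AddCommGroup B] [Module ℝ B]
    (F : Basis (Fin 2) ℝ A) (F' : Basis (Fin 2) ℝ B) (T : A →ₗ[ℝ] B) (h0 : T (F 0) = F' 1)
    (h1 : T (F 1) = F' 0) (v : A) : F'.repr (T v) 1 = F.repr v 0 := by
  have h : F'.repr (T v) = F'.repr (∑ i, F.repr v i • T (F i)) := by
    conv_lhs => rw [← F.sum_repr v, map_sum]
    simp only [map_smul]
  rw [h, Fin.sum_univ_two, h0, h1]
  simp

theorem HasSign.det_symm {ι : Type*} [Fintype ι] [DecidableEq ι] {e f : Basis ι ℝ V} {s : ℤ}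
    (h : HasSign (e.det f) s) : HasSign (f.det e) s := by
  have h1 : e.det f * f.det e = 1 := by rw [Basis.det_mul_det, Basis.det_self]
  rcases h with ⟨hs, h⟩ | ⟨hs, h⟩
  · exact Or.inl ⟨hs, by by_contra hn; nlinarith⟩
  · exact Or.inr ⟨hs, by by_contra hn; nlinarith⟩

/-- The determinant of a matrix that is block diagonal, up to permutations of rows and columns,
with `n` blocks of size one equal to `1` and `k` blocks of size two, in each of which the rows are
exchanged. -/
theorem det_of_swapped_blocks {k n : ℕ} (M : Matrix (Fin m) (Fin m) ℝ)
    (lam ind : (Fin k × Fin 2) ⊕ Fin n ≃ Fin m) (Q : Fin k → Matrix (Fin 2) (Fin 2) ℝ)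
    (h0 : ∀ i i' c, M (lam (Sum.inl (i, 0))) (ind (Sum.inl (i', c))) = if i = i' then Q i 1 c else 0)
    (h1 : ∀ i i' c, M (lam (Sum.inl (i, 1))) (ind (Sum.inl (i', c))) = if i = i' then Q i 0 c else 0)
    (h2 : ∀ i c j, M (lam (Sum.inl (i, c))) (ind (Sum.inr j)) = 0)
    (h3 : ∀ j i c, M (lam (Sum.inr j)) (ind (Sum.inl (i, c))) = 0)
    (h4 : ∀ j j', M (lam (Sum.inr j)) (ind (Sum.inr j')) = if j = j' then 1 else 0) :
    ((Equiv.Perm.sign (ind.symm.trans lam) : ℤ) : ℝ) * M.det = ∏ i, -(Q i).det := by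
  -- Rows are numbered through `lam` and columns through `ind`; the sign on the left is the cost of
  -- this discrepancy. The factors `Fin 2` and `Fin k` are exchanged because `Matrix.blockDiagonal`
  -- takes the block number as second coordinate.
  rw [← Matrix.det_permute, ← Matrix.det_submatrix_equiv_self
    (((Equiv.prodComm (Fin 2) (Fin k)).sumCongr (Equiv.refl (Fin n))).trans ind)]
  have h : ((M.submatrix (ind.symm.trans lam) id).submatrix
      (((Equiv.prodComm (Fin 2) (Fin k)).sumCongr (Equiv.refl (Fin n))).trans ind)
      (((Equiv.prodComm (Fin 2) (Fin k)).sumCongr (Equiv.refl (Fin n))).trans ind)) =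
      Matrix.fromBlocks (Matrix.blockDiagonal fun i => (Q i).submatrix (Equiv.swap 0 1) id) 0 0 1 := by
    ext (⟨c, i⟩ | j) (⟨d, i'⟩ | j')
    · fin_cases c
      · simp [h0, Matrix.blockDiagonal_apply]
      · simp [h1, Matrix.blockDiagonal_apply]
    · simp [h2]
    · simp [h3]
    · simp [h4, Matrix.one_apply]
  rw [h, Matrix.det_fromBlocks_zero₂₁, Matrix.det_blockDiagonal, Matrix.det_one, mul_one]
  refine Finset.prod_congr rfl fun i _ => ?_
  rw [Matrix.det_permute]
  simp

end Complement

/-! ### Local intersection signs on the surface. -/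

section Signs

variable {S : Type} [TopologicalSpace S] [ChartedSpace Plane S]

theorem basis_two_ext {A : Type*} [AddCommGroup A] [Module ℝ A] {b F : Basis (Fin 2) ℝ A}
    (h0 : b 0 = F 0) (h1 : b 1 = F 1) : b = F :=
  Basis.eq_of_apply_eq fun i => by fin_cases i <;> assumption

theorem posPair_basis_iff {o : OrientationField S} {p : S}
    {F : Basis (Fin 2) ℝ (TangentSpace (𝓡 2) p)} :
    PosPair o p (F 0) (F 1) ↔ F.orientation = o p :=
  ⟨fun ⟨_, h0, h1, h⟩ => basis_two_ext h0 h1 ▸ h, fun h => ⟨F, rfl, rfl, h⟩⟩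

/-- Exchanging the two vectors negates the determinant, and the value `0` of `localSign` is excluded
because the vectors form a basis. -/
theorem hasSign_localSign {o : OrientationField S} {p : S}
    {E F : Basis (Fin 2) ℝ (TangentSpace (𝓡 2) p)} (hE : E.orientation = o p) :
    HasSign (E.det F) (localSign o p (F 0) (F 1)) := by
  have key : ∀ F : Basis (Fin 2) ℝ (TangentSpace (𝓡 2) p),
      PosPair o p (F 0) (F 1) ↔ 0 < E.det F := by
    intro F
    rw [posPair_basis_iff, ← Basis.orientation_eq_iff_det_pos, hE, eq_comm]
  have hs : PosPair o p (F 1) (F 0) ↔ E.det F < 0 := by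
    have := key (F.reindex (Equiv.swap 0 1))
    have hd : E.det (F.reindex (Equiv.swap 0 1)) = -E.det F := by
      have : ⇑(F.reindex (Equiv.swap 0 1)) = F ∘ Equiv.swap 0 1 := by funext i; simp
      rw [this, AlternatingMap.map_swap _ _ (by decide)]
    rw [hd] at this
    simpa using this
  unfold localSign
  split_ifs with h1 h2
  · exact HasSign.one_iff.2 ((key F).1 h1)
  · exact HasSign.neg_one_iff.2 (hs.1 h2)
  · rcases (E.isUnit_det F).ne_zero.lt_or_gt with h | h
    · exact absurd (hs.2 h) h2
    · exact absurd ((key F).2 h) h1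

theorem exists_basis_orientation {p : S} (o : Orientation ℝ (TangentSpace (𝓡 2) p) (Fin 2)) :
    ∃ E : Basis (Fin 2) ℝ (TangentSpace (𝓡 2) p), E.orientation = o := by
  let b : Basis (Fin 2) ℝ (TangentSpace (𝓡 2) p) := (EuclideanSpace.basisFun (Fin 2) ℝ).toBasis
  exact ⟨b.adjustToOrientation o, b.orientation_adjustToOrientation o⟩

theorem exists_basis_of_linearIndependent {p : S} (u v : TangentSpace (𝓡 2) p)
    (h : LinearIndependent ℝ ![u, v]) :
    ∃ E : Basis (Fin 2) ℝ (TangentSpace (𝓡 2) p), E 0 = u ∧ E 1 = v := by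
  have hf : finrank ℝ (TangentSpace (𝓡 2) p) = 2 := by
    change finrank ℝ Plane = 2
    simp
  have : FiniteDimensional ℝ (TangentSpace (𝓡 2) p) := inferInstanceAs (FiniteDimensional ℝ Plane)
  exact ⟨basisOfLinearIndependentOfCardEqFinrank h (by simp [hf]), by simp, by simp⟩

namespace Diagram

variable {m l h : ℕ} {D : Diagram S m l h} {x : Sym S m}

/-- The determinant is factored through the basis that witnesses positivity of `w`: renumbering the
points contributes `1`, and the comparison of planes contributes one local sign per point. -/
theorem IsPosSym.hasSign {w : Basis (Fin (m + m)) ℝ (SymTangent x)} (hw : D.IsPosSym x w)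
    (e : Fin m ≃ {p : S // p ∈ x})
    (F : ∀ p : {p : S // p ∈ x}, Basis (Fin 2) ℝ (TangentSpace (𝓡 2) p.1)) :
    HasSign (w.det (symBasis x e F)) (∏ i, localSign D.o (e i).1 (F (e i) 0) (F (e i) 1)) := by
  obtain ⟨e', E, hE, hw⟩ := hw
  have h1 : HasSign (w.det (symBasis x e' E)) 1 :=
    HasSign.one_iff.2 ((Basis.orientation_eq_iff_det_pos _ _).1 hw)
  have h2 : HasSign ((symBasis x e' E).det (symBasis x e E)) 1 := by
    rw [symBasis_det_reorder]; exact HasSign.one_iff.2 one_pos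
  have h3 : HasSign ((symBasis x e E).det (symBasis x e F))
      (∏ i, localSign D.o (e i).1 (F (e i) 0) (F (e i) 1)) := by
    rw [symBasis_det_symBasis]
    exact HasSign.prod fun i => hasSign_localSign (hE _)
  simpa [Basis.det_mul_det] using (h1.mul h2).mul h3

theorem exists_isPosSym (e : Fin m ≃ {p : S // p ∈ x}) : ∃ w, D.IsPosSym x w := by
  choose E hE using fun p : {p : S // p ∈ x} => exists_basis_orientation (D.o p.1)
  exact ⟨symBasis x e E, e, E, hE, rfl⟩

end Diagram

end Signs

/-! ### Velocities of periodic curves. -/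

section Curves

variable {S : Type} [TopologicalSpace S] [ChartedSpace Plane S]

theorem IsSmoothCircle.apply_add_int {γ : ℝ → S} (hγ : IsSmoothCircle γ) (n : ℤ) (t : ℝ) :
    γ (t + n) = γ t := by
  have : Function.Periodic γ 1 := hγ.periodic
  simpa using (this.int_mul n) t

theorem IsSmoothCircle.apply_fract {γ : ℝ → S} (hγ : IsSmoothCircle γ) (t : ℝ) :
    γ (Int.fract t) = γ t := by
  conv_rhs => rw [← Int.fract_add_floor t, hγ.apply_add_int]

/-- Two parameters of a point differ by an integer, and periodicity gives equal velocities. This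
reconciles the parameters recorded in a labelling with those of the torus point. -/
theorem IsSmoothCircle.velocity_congr {γ : ℝ → S} (hγ : IsSmoothCircle γ) {s t : ℝ}
    (h : γ s = γ t) : (velocity γ s : Plane) = velocity γ t := by
  have hf : Int.fract s = Int.fract t := hγ.injOn ⟨Int.fract_nonneg s, Int.fract_lt_one s⟩
    ⟨Int.fract_nonneg t, Int.fract_lt_one t⟩ (by rw [hγ.apply_fract, hγ.apply_fract, h])
  obtain ⟨n, hn⟩ := Int.fract_eq_fract.1 hf
  have hs : s = t + n := by linarith
  subst hs
  have hd : MDifferentiableAt 𝓘(ℝ, ℝ) (𝓡 2) γ (t + n) := hγ.smooth.mdifferentiable (by simp) _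
  have h1 : HasMFDerivAt 𝓘(ℝ, ℝ) 𝓘(ℝ, ℝ) (fun u : ℝ => u + n) t (ContinuousLinearMap.id ℝ ℝ) :=
    ((hasFDerivAt_id t).add_const (n : ℝ)).hasMFDerivAt
  have h2 := (hd.hasMFDerivAt.comp t h1).congr_of_eventuallyEq
    (Filter.Eventually.of_forall fun u => (hγ.apply_add_int n u).symm)
  unfold velocity
  rw [h2.mfderiv]
  rfl

end Curves

/-- Subtracting a relation between `u` and `c` from its image under `T` eliminates `c` and leaves a
relation between `u` and `T u`. -/
theorem linearIndependent_of_map_eq {V : Type*} [AddCommGroup V] [Module ℝ V] (T : V →ₗ[ℝ] V)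
    {u c : V} (hu : LinearIndependent ℝ ![u, T u]) (hc : T c = c) (h0 : c ≠ 0) :
    LinearIndependent ℝ ![u, c] := by
  rw [LinearIndependent.pair_iff] at hu ⊢
  intro a b hab
  have h3 := congrArg T hab
  rw [map_add, map_smul, map_smul, map_zero, hc] at h3
  obtain ⟨rfl, -⟩ := hu a (-a) (by rw [neg_smul, ← sub_eq_add_neg, sub_eq_zero]
                                   exact add_right_cancel (hab.trans h3.symm))
  rw [zero_smul, zero_add] at hab
  exact ⟨rfl, (smul_eq_zero.1 hab).resolve_right h0⟩

section VecAt

variable {S : Type} [TopologicalSpace S] [ChartedSpace Plane S] {m : ℕ}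

theorem vecAt_congr (x : Sym S m) {p q : S} (h : p = q) (v : TangentSpace (𝓡 2) p)
    (w : TangentSpace (𝓡 2) q) (hv : (v : Plane) = w) : vecAt x p v = vecAt x q w := by
  subst h; exact congrArg _ hv

theorem vecAt_of_eq (x : Sym S m) (q : S) (p : {p : S // p ∈ x}) (h : p.1 = q)
    (v : TangentSpace (𝓡 2) q) : (vecAt x q v p : Plane) = v := by
  subst h; exact vecAt_self x p v

end VecAt

/-! ### The differential of the involution, transversality and orientations. -/

namespace Diagram

variable {S : Type} [TopologicalSpace S] [ChartedSpace Plane S] {m l h : ℕ}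
  (D : Diagram S m l h)

theorem mdifferentiableAt_τ (p : S) : MDifferentiableAt (𝓡 2) (𝓡 2) D.τ p :=
  D.τ_smooth.mdifferentiable (by simp) p

theorem mfderiv_τ_congr {p q : S} (hpq : p = q) (v : TangentSpace (𝓡 2) p) :
    (mfderiv (𝓡 2) (𝓡 2) D.τ p v : Plane) = mfderiv (𝓡 2) (𝓡 2) D.τ q (v : Plane) := by
  subst hpq; rfl

theorem mfderiv_τ_τ (p : S) (v : TangentSpace (𝓡 2) p) :
    (mfderiv (𝓡 2) (𝓡 2) D.τ (D.τ p) (mfderiv (𝓡 2) (𝓡 2) D.τ p v) : Plane) = v := by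
  have h1 := ((D.mdifferentiableAt_τ (D.τ p)).hasMFDerivAt.comp p
    (D.mdifferentiableAt_τ p).hasMFDerivAt).congr_of_eventuallyEq
      (f₁ := id) (Filter.Eventually.of_forall fun q => (D.τ_invol q).symm)
  have h2 := hasMFDerivAt_unique h1 (hasMFDerivAt_id p)
  exact congrArg (fun f : Plane →L[ℝ] Plane => f v) h2

theorem velocity_β (j : Fin m) (t : ℝ) :
    (velocity (D.β j) t : Plane) = mfderiv (𝓡 2) (𝓡 2) D.τ (D.α j t) (velocity (D.α j) t) := by
  have hd : MDifferentiableAt 𝓘(ℝ, ℝ) (𝓡 2) (D.α j) t :=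
    (D.α_circle j).smooth.mdifferentiable (by simp) _
  exact mfderiv_comp_apply t (D.mdifferentiableAt_τ _) hd 1

theorem τ_fix (i : Fin l) (t : ℝ) : D.τ (D.fix i t) = D.fix i t := by
  have : D.fix i t ∈ {p | D.τ p = p} := by
    rw [D.fix_union]; exact mem_iUnion.2 ⟨i, t, rfl⟩
  exact this

theorem mfderiv_τ_velocity_fix (i : Fin l) (t : ℝ) :
    (mfderiv (𝓡 2) (𝓡 2) D.τ (D.fix i t) (velocity (D.fix i) t) : Plane) =
      velocity (D.fix i) t := by
  have hd : MDifferentiableAt 𝓘(ℝ, ℝ) (𝓡 2) (D.fix i) t :=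
    (D.fix_circle i).smooth.mdifferentiable (by simp) _
  have h1 := ((D.mdifferentiableAt_τ _).hasMFDerivAt.comp t
    hd.hasMFDerivAt).congr_of_eventuallyEq
      (f₁ := D.fix i) (Filter.Eventually.of_forall fun q => (D.τ_fix i q).symm)
  have h2 := hasMFDerivAt_unique h1 hd.hasMFDerivAt
  exact congrArg (fun f : ℝ →L[ℝ] Plane => f 1) h2

theorem linearIndependent_velocity {i j : Fin m} {s t : ℝ} (hp : D.τ (D.α j t) = D.α i s) :
    LinearIndependent ℝ (![velocity (D.α i) s,
      mfderiv (𝓡 2) (𝓡 2) D.τ (D.α j t) (velocity (D.α j) t)] : Fin 2 → Plane) := by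
  have h1 : LinearIndependent ℝ (![velocity (D.α i) s, velocity (D.β j) t] : Fin 2 → Plane) :=
    D.α_transverse i j s t hp
  rwa [D.velocity_β] at h1

/-- At a point of `C` an alpha curve crosses its own mirror image transversely, whereas the
differential of `τ` fixes the direction of `C`. -/
theorem linearIndependent_velocity_fix {i : Fin m} {j : Fin l} {s t : ℝ}
    (hp : D.α i s = D.fix j t) :
    LinearIndependent ℝ (![velocity (D.α i) s, velocity (D.fix j) t] : Fin 2 → Plane) := by
  have hτ : D.τ (D.α i s) = D.α i s := by rw [hp, D.τ_fix]
  let T : Plane →L[ℝ] Plane := mfderiv (𝓡 2) (𝓡 2) D.τ (D.α i s)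
  let c : Plane := velocity (D.fix j) t
  have h1 : T c = c :=
    (D.mfderiv_τ_congr hp (velocity (D.fix j) t : Plane)).trans (D.mfderiv_τ_velocity_fix j t)
  exact linearIndependent_of_map_eq T.toLinearMap (c := c) (D.linearIndependent_velocity hτ) h1
    ((D.fix_circle j).immersion t)

theorem oQuot_eq_or {p : S} : D.oQuot p = D.o p ∨ D.oQuot p = -D.o p := by
  obtain ⟨E, hE⟩ := exists_basis_orientation (D.o p)
  rw [← hE]
  exact E.orientation_eq_or_eq_neg _

theorem posPair_τ_iff {p : S} {u v : TangentSpace (𝓡 2) p} :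
    PosPair D.o (D.τ p) (mfderiv (𝓡 2) (𝓡 2) D.τ p v) (mfderiv (𝓡 2) (𝓡 2) D.τ p u) ↔
      PosPair D.o p u v := by
  refine ⟨fun h => ?_, D.τ_reversing p u v⟩
  have h1 := D.τ_reversing _ _ _ h
  have h2 : ∀ q (_ : q = p) (u' v' : TangentSpace (𝓡 2) q), (u' : Plane) = u → (v' : Plane) = v →
      PosPair D.o q u' v' → PosPair D.o p u v := by
    rintro q rfl u' v' rfl rfl h; exact h
  exact h2 _ (D.τ_invol p) _ _ (D.mfderiv_τ_τ p u) (D.mfderiv_τ_τ p v) h1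

theorem localSign_eq_of_iff {o o' : OrientationField S} {p q : S} {u v : TangentSpace (𝓡 2) p}
    {u' v' : TangentSpace (𝓡 2) q} (h1 : PosPair o p u v ↔ PosPair o' q u' v')
    (h2 : PosPair o p v u ↔ PosPair o' q v' u') : localSign o p u v = localSign o' q u' v' := by
  unfold localSign
  split_ifs <;> tauto

/-- The reversal of orientation by `τ` is compensated by the exchange of the two arguments. -/
theorem localSign_τ (p : S) (u v : TangentSpace (𝓡 2) p) :
    localSign D.o (D.τ p) (mfderiv (𝓡 2) (𝓡 2) D.τ p v) (mfderiv (𝓡 2) (𝓡 2) D.τ p u) =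
      localSign D.o p u v :=
  localSign_eq_of_iff D.posPair_τ_iff D.posPair_τ_iff

theorem localSign_congr {o : OrientationField S} {p q : S} (hpq : p = q)
    {u v : TangentSpace (𝓡 2) p} {u' v' : TangentSpace (𝓡 2) q} (hu : (u : Plane) = u')
    (hv : (v : Plane) = v') : localSign o p u v = localSign o q u' v' := by
  subst hpq
  exact congrArg₂ (localSign o p) hu hv

theorem τ_ne {p : S} (hp : D.τ p ≠ p) : D.τ (D.τ p) ≠ D.τ p := by
  rw [D.τ_invol]; exact hp.symm

theorem posPair_unique {o o' : OrientationField S} {p : S} {u v : TangentSpace (𝓡 2) p}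
    (h : PosPair o p u v) (h' : PosPair o' p u v) : o p = o' p := by
  obtain ⟨b, h0, h1, hb⟩ := h
  obtain ⟨b', h0', h1', hb'⟩ := h'
  rw [← hb, ← hb', basis_two_ext (h0.trans h0'.symm) (h1.trans h1'.symm)]

theorem orientation_swap {p : S} (b : Basis (Fin 2) ℝ (TangentSpace (𝓡 2) p)) :
    (b.reindex (Equiv.swap 0 1)).orientation = -b.orientation := by
  have hd : HasSign (b.det (b.reindex (Equiv.swap 0 1))) (-1) := by
    have : ⇑(b.reindex (Equiv.swap 0 1)) = b ∘ Equiv.swap 0 1 := by funext i; simp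
    rw [this, AlternatingMap.map_swap _ _ (by decide), Basis.det_self]
    exact HasSign.neg_one_iff.2 (by norm_num)
  simpa using orientation_smul_eq_of_hasSign hd

theorem PosPair.swap {o : OrientationField S} {p : S} {u v : TangentSpace (𝓡 2) p}
    (h : PosPair o p u v) : PosPair (fun q => -o q) p v u := by
  obtain ⟨b, h0, h1, hb⟩ := h
  exact ⟨b.reindex (Equiv.swap 0 1), by simpa using h1, by simpa using h0,
    by rw [orientation_swap, hb]⟩

/-- `τ` preserves `oQuot` and reverses `o`, so the two orientations agree at exactly one of `p` and
`τ p`. -/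
theorem mem_plusPart_or {p : S} (hp : D.τ p ≠ p) : p ∈ D.plusPart ∨ D.τ p ∈ D.plusPart := by
  rcases D.oQuot_eq_or (p := p) with h | h
  · exact Or.inl ⟨hp, h⟩
  · refine Or.inr ⟨D.τ_ne hp, ?_⟩
    obtain ⟨E, hE⟩ := exists_basis_orientation (D.o p)
    have h1 : PosPair D.o p (E 0) (E 1) := posPair_basis_iff.2 hE
    obtain ⟨b, h0, h2, hb⟩ := PosPair.swap h1
    exact posPair_unique (D.oQuot_invariant p hp _ _ ⟨b, h0, h2, hb.trans h.symm⟩)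
      (D.τ_reversing p _ _ h1)

theorem notMem_plusPart_τ {p : S} (hp : p ∈ D.plusPart) : D.τ p ∉ D.plusPart := by
  rintro ⟨-, h⟩
  obtain ⟨E, hE⟩ := exists_basis_orientation (D.o p)
  have h1 : PosPair D.o p (E 0) (E 1) := posPair_basis_iff.2 hE
  have h2 : PosPair D.oQuot p (E 0) (E 1) := posPair_basis_iff.2 (hE.trans hp.2.symm)
  have h3 := PosPair.swap (D.oQuot_invariant p hp.1 _ _ h2)
  have h4 := posPair_unique h3 (D.τ_reversing p _ _ h1)
  rw [h] at h4
  exact Module.Ray.ne_neg_self _ h4.symm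

end Diagram

/-! ### Torus points, stratum points and labellings. -/

namespace Diagram

variable {S : Type} [TopologicalSpace S] [ChartedSpace Plane S] {m l h : ℕ}

theorem index_eq {D : Diagram S m l h} {i j : Fin m} {s t : ℝ}
    (hst : D.α i s = D.α j t) : i = j := by
  by_contra hij
  exact Set.disjoint_left.1 (D.α_disjoint i j hij) ⟨s, rfl⟩ ⟨t, hst.symm⟩

/-- Parameters on the alpha curves of the points of a configuration in the torus. -/
structure TorusPoint (D : Diagram S m l h) (x : Sym S m) where
  t : Fin m → ℝ
  eq : (x : Multiset S) = Finset.univ.val.map fun i => D.α i (t i)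

namespace TorusPoint

variable {D : Diagram S m l h} {x : Sym S m} (T : D.TorusPoint x)

theorem mem_iff {p : S} : p ∈ x ↔ ∃ i, D.α i (T.t i) = p := by
  rw [← Sym.mem_coe, T.eq]; simp

theorem mem (i : Fin m) : D.α i (T.t i) ∈ x := T.mem_iff.2 ⟨i, rfl⟩


theorem α_eq {i : Fin m} {s : ℝ} (hs : D.α i s ∈ x) : D.α i (T.t i) = D.α i s := by
  obtain ⟨j, hj⟩ := T.mem_iff.1 hs
  obtain rfl := index_eq hj
  exact hj

/-- The numbering of the points of the configuration by the alpha curves that contain them. -/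
def equiv : Fin m ≃ {p : S // p ∈ x} :=
  Equiv.ofBijective (fun i => ⟨D.α i (T.t i), T.mem i⟩)
    ⟨fun _ _ hij => index_eq (congrArg Subtype.val hij),
      fun p => (T.mem_iff.1 p.2).imp fun _ hi => Subtype.ext hi⟩

theorem nodup (T : D.TorusPoint x) : (x : Multiset S).Nodup := by
  rw [T.eq]
  exact Finset.univ.nodup.map fun _ _ hij => index_eq hij

end TorusPoint

theorem exists_torusPoint {D : Diagram S m l h} {x : Sym S m} (hx : x ∈ D.torus) :
    Nonempty (D.TorusPoint x) := by
  obtain ⟨t, ht⟩ := hx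
  exact ⟨⟨t, ht⟩⟩

theorem τ_mem {D : Diagram S m l h} {x : Sym S m} (hx : x ∈ D.puncturedFixedLocus) {p : S}
    (hp : p ∈ x) : D.τ p ∈ x := by
  rw [← hx.1]; exact Sym.mem_map.2 ⟨p, hp, rfl⟩

namespace StratumPoint

variable {D : Diagram S m l h} {x : Sym S m} {k n : ℕ} (P : D.StratumPoint x k n)

theorem mem_iff {p : S} : p ∈ x ↔ (∃ i, P.z i = p) ∨ (∃ i, D.τ (P.z i) = p) ∨
    ∃ j, D.fix (P.comp j) (P.par j) = p := by
  rw [← Sym.mem_coe, P.eq]; simp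

theorem z_mem_sym (i : Fin k) : P.z i ∈ x := P.mem_iff.2 (Or.inl ⟨i, rfl⟩)

theorem τz_mem_sym (i : Fin k) : D.τ (P.z i) ∈ x := P.mem_iff.2 (Or.inr (Or.inl ⟨i, rfl⟩))

theorem c_mem_sym (j : Fin n) : D.fix (P.comp j) (P.par j) ∈ x :=
  P.mem_iff.2 (Or.inr (Or.inr ⟨j, rfl⟩))

/-- The enumeration of the vectors of `frame`. -/
def index : (Fin k × Fin 2) ⊕ Fin n ≃ Fin m :=
  (finProdFinEquiv.sumCongr (Equiv.refl _)).trans (finSumFinEquiv.trans (finCongr P.card_eq))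

theorem frame_index_inl (E : ∀ i, Basis (Fin 2) ℝ (TangentSpace (𝓡 2) (P.z i))) (i : Fin k)
    (c : Fin 2) : P.frame E (P.index (Sum.inl (i, c))) = vecAt x (P.z i) (E i c) +
      vecAt x (D.τ (P.z i)) (mfderiv (𝓡 2) (𝓡 2) D.τ (P.z i) (E i c)) := by
  have : Fin.cast P.card_eq.symm (P.index (Sum.inl (i, c))) =
      Fin.castAdd n (finProdFinEquiv (i, c)) := rfl
  rw [frame, this, Fin.append_left, Equiv.symm_apply_apply]

theorem frame_index_inr (E : ∀ i, Basis (Fin 2) ℝ (TangentSpace (𝓡 2) (P.z i))) (j : Fin n) :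
    P.frame E (P.index (Sum.inr j)) =
      vecAt x (D.fix (P.comp j) (P.par j)) (velocity (D.fix (P.comp j)) (P.par j)) := by
  have : Fin.cast P.card_eq.symm (P.index (Sum.inr j)) = Fin.natAdd (k * 2) j := rfl
  rw [frame, this, Fin.append_right]

end StratumPoint

namespace Labelling

variable {D : Diagram S m l h} {x : Sym S m} {k n : ℕ} {P : D.StratumPoint x k n}
  (L : Labelling P) (T : D.TorusPoint x)

theorem list_index_inl (i : Fin k) (c : Fin 2) :
    L.list (P.index (Sum.inl (i, c))) = if c = 0 then L.r i else L.σ (L.r i) := by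
  have : Fin.cast P.card_eq.symm (P.index (Sum.inl (i, c))) =
      Fin.castAdd n (finProdFinEquiv (i, c)) := rfl
  rw [list, this, Fin.append_left, Equiv.symm_apply_apply]

theorem list_index_inr (j : Fin n) : L.list (P.index (Sum.inr j)) = L.s j := by
  have : Fin.cast P.card_eq.symm (P.index (Sum.inr j)) = Fin.natAdd (k * 2) j := rfl
  rw [list, this, Fin.append_right]

theorem α_σ_r (i : Fin k) : D.α (L.σ (L.r i)) (L.tβ i) = D.τ (P.z i) := by
  rw [← L.z_mem_β, β, D.τ_invol]

theorem point_r (i : Fin k) : D.α (L.r i) (T.t (L.r i)) = P.z i := by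
  rw [T.α_eq (s := L.tα i), L.z_mem_α]
  rw [L.z_mem_α]; exact P.z_mem_sym i

theorem point_σ_r (i : Fin k) : D.α (L.σ (L.r i)) (T.t (L.σ (L.r i))) = D.τ (P.z i) := by
  rw [T.α_eq (s := L.tβ i), L.α_σ_r]
  rw [L.α_σ_r]; exact P.τz_mem_sym i

theorem point_s (j : Fin n) : D.α (L.s j) (T.t (L.s j)) = D.fix (P.comp j) (P.par j) := by
  rw [T.α_eq (s := L.tc j), L.c_mem_α]
  rw [L.c_mem_α]; exact P.c_mem_sym j

/-- The three kinds of indices are separated by where their points lie: in $\Sigma^+$, in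
$\tau(\Sigma^+)$, or on $C$. -/
theorem list_injective (T : D.TorusPoint x) : Function.Injective L.list := by
  have hrs : ∀ i j, L.r i ≠ L.s j := by
    intro i j hij
    apply (P.z_mem i).1
    rw [← L.point_r T, hij, L.point_s T, D.τ_fix]
  have hσs : ∀ i j, L.σ (L.r i) ≠ L.s j := by
    intro i j hij
    apply D.τ_ne (P.z_mem i).1
    rw [← L.point_σ_r T, hij, L.point_s T, D.τ_fix]
  have hrσ : ∀ i j, L.r i ≠ L.σ (L.r j) := by
    intro i j hij
    apply D.notMem_plusPart_τ (P.z_mem j)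
    rw [← L.point_σ_r T, ← hij, L.point_r T]
    exact P.z_mem i
  intro a b hab
  obtain ⟨a, rfl⟩ := P.index.surjective a
  obtain ⟨b, rfl⟩ := P.index.surjective b
  congr 1
  rcases a with ⟨i, c⟩ | j <;> rcases b with ⟨i', c'⟩ | j'
  · rw [list_index_inl, list_index_inl] at hab
    split_ifs at hab with h1 h2 h2
    · rw [h1, h2, L.r_injective hab]
    · exact absurd hab (hrσ _ _)
    · exact absurd hab.symm (hrσ _ _)
    · rw [Fin.eq_one_of_ne_zero c h1, Fin.eq_one_of_ne_zero c' h2,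
        L.r_injective (L.σ.injective hab)]
  · rw [list_index_inl, list_index_inr] at hab
    split_ifs at hab
    · exact absurd hab (hrs _ _)
    · exact absurd hab (hσs _ _)
  · rw [list_index_inl, list_index_inr] at hab
    split_ifs at hab
    · exact absurd hab.symm (hrs _ _)
    · exact absurd hab.symm (hσs _ _)
  · rw [list_index_inr, list_index_inr] at hab
    rw [L.s_injective hab]

/-- The permutation `(r(1), σ(r(1)), …, r(k), σ(r(k)), s(1), …, s(n))`. -/
def perm : Equiv.Perm (Fin m) :=
  Equiv.ofBijective L.list (Finite.injective_iff_bijective.1 (L.list_injective T))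

theorem perm_index_zero (i : Fin k) : L.perm T (P.index (Sum.inl (i, 0))) = L.r i := by
  simp [perm, list_index_inl]

theorem perm_index_one (i : Fin k) : L.perm T (P.index (Sum.inl (i, 1))) = L.σ (L.r i) := by
  simp [perm, list_index_inl]

theorem perm_index_inr (j : Fin n) : L.perm T (P.index (Sum.inr j)) = L.s j := by
  simp [perm, list_index_inr]

theorem velocity_r (i : Fin k) :
    (velocity (D.α (L.r i)) (T.t (L.r i)) : Plane) = velocity (D.α (L.r i)) (L.tα i) :=
  (D.α_circle _).velocity_congr (by rw [L.point_r, L.z_mem_α])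

theorem velocity_σ_r (i : Fin k) : (velocity (D.α (L.σ (L.r i))) (T.t (L.σ (L.r i))) : Plane) =
    velocity (D.α (L.σ (L.r i))) (L.tβ i) :=
  (D.α_circle _).velocity_congr (by rw [L.point_σ_r, L.α_σ_r])

theorem velocity_s (j : Fin n) :
    (velocity (D.α (L.s j)) (T.t (L.s j)) : Plane) = velocity (D.α (L.s j)) (L.tc j) :=
  (D.α_circle _).velocity_congr (by rw [L.point_s, L.c_mem_α])

theorem mfderiv_velocity_α (i : Fin k) :
    (mfderiv (𝓡 2) (𝓡 2) D.τ (P.z i) (velocity (D.α (L.r i)) (L.tα i) : Plane) : Plane) =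
      velocity (D.β (L.r i)) (L.tα i) := by
  rw [D.velocity_β]
  exact (D.mfderiv_τ_congr (L.z_mem_α i) _).symm

theorem mfderiv_velocity_β (i : Fin k) :
    (mfderiv (𝓡 2) (𝓡 2) D.τ (P.z i) (velocity (D.β (L.σ (L.r i))) (L.tβ i) : Plane) : Plane) =
      velocity (D.α (L.σ (L.r i))) (L.tβ i) := by
  rw [D.velocity_β]
  refine Eq.trans ?_ (D.mfderiv_τ_τ _ _)
  exact (D.mfderiv_τ_congr (L.z_mem_β i) _).symm

/-- The second vectors of bases of the tangent planes at the points of the configuration, that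
start with the velocities of the alpha curves. -/
def transverseVec (a : (Fin k × Fin 2) ⊕ Fin n) : Plane :=
  Sum.elim (fun q => if q.2 = 0 then (velocity (D.β (L.σ (L.r q.1))) (L.tβ q.1) : Plane)
    else velocity (D.β (L.r q.1)) (L.tα q.1))
    (fun j => velocity (D.fix (P.comp j)) (P.par j)) a

/-- The second vectors are chosen so that the differential of `τ` exchanges the bases at `z_i` and
`τ(z_i)`, with first and second vectors swapped. -/
theorem exists_adapted_bases :
    ∃ F : ∀ p : {p : S // p ∈ x}, Basis (Fin 2) ℝ (TangentSpace (𝓡 2) p.1),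
      (∀ i, F (T.equiv i) 0 = velocity (D.α i) (T.t i)) ∧
      ∀ a, (F (T.equiv (L.perm T (P.index a))) 1 : Plane) = L.transverseVec a := by
  have key : ∀ a, LinearIndependent ℝ (![velocity (D.α (L.perm T (P.index a)))
      (T.t (L.perm T (P.index a))), L.transverseVec a] : Fin 2 → Plane) := by
    rintro (⟨i, c⟩ | j)
    · fin_cases c
      · change LinearIndependent ℝ (![velocity (D.α (L.perm T (P.index (Sum.inl (i, 0)))))
          (T.t (L.perm T (P.index (Sum.inl (i, 0))))),
          velocity (D.β (L.σ (L.r i))) (L.tβ i)] : Fin 2 → Plane)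
        rw [perm_index_zero, velocity_r]
        exact D.α_transverse _ _ _ _ ((L.z_mem_β i).trans (L.z_mem_α i).symm)
      · change LinearIndependent ℝ (![velocity (D.α (L.perm T (P.index (Sum.inl (i, 1)))))
          (T.t (L.perm T (P.index (Sum.inl (i, 1))))),
          velocity (D.β (L.r i)) (L.tα i)] : Fin 2 → Plane)
        rw [perm_index_one, velocity_σ_r]
        exact D.α_transverse _ _ _ _ (by rw [L.z_mem_α, L.α_σ_r])
    · change LinearIndependent ℝ (![velocity (D.α (L.perm T (P.index (Sum.inr j))))
          (T.t (L.perm T (P.index (Sum.inr j)))),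
          velocity (D.fix (P.comp j)) (P.par j)] : Fin 2 → Plane)
      rw [perm_index_inr, velocity_s]
      exact D.linearIndependent_velocity_fix (L.c_mem_α j)
  -- The family is indexed by points, not by labels. Each point carries exactly one label `a`, so
  -- the condition quantified over `a` imposes a single constraint.
  have key' : ∀ p : {p : S // p ∈ x}, ∃ b : Basis (Fin 2) ℝ (TangentSpace (𝓡 2) p.1),
      ∀ a, T.equiv (L.perm T (P.index a)) = p →
        (b 0 : Plane) = velocity (D.α (L.perm T (P.index a))) (T.t (L.perm T (P.index a))) ∧
        (b 1 : Plane) = L.transverseVec a := by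
    intro p
    obtain ⟨i, rfl⟩ := T.equiv.surjective p
    obtain ⟨i, rfl⟩ := (L.perm T).surjective i
    obtain ⟨a, rfl⟩ := P.index.surjective i
    obtain ⟨b, h0, h1⟩ := exists_basis_of_linearIndependent
      (p := (T.equiv (L.perm T (P.index a))).1) _ _ (key a)
    refine ⟨b, fun a' ha' => ?_⟩
    obtain rfl := P.index.injective ((L.perm T).injective (T.equiv.injective ha'))
    exact ⟨h0, h1⟩
  choose F hF using key'
  refine ⟨F, fun i => ?_, fun a => (hF _ a rfl).2⟩
  obtain ⟨i, rfl⟩ := (L.perm T).surjective i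
  obtain ⟨a, rfl⟩ := P.index.surjective i
  exact (hF _ a rfl).1

end Labelling

end Diagram

/-! ### Tangent spaces at the intersection point and the determinant of the frame. -/

namespace Diagram

variable {S : Type} [TopologicalSpace S] [ChartedSpace Plane S] {m l h : ℕ}

theorem add_eq_map_add {V : Type*} [AddCommGroup V] [Module ℝ V] (A : V →ₗ[ℝ] V)
    {a b c d a' b' c' d' : V} (ha : a = a') (hb : b = b') (hc : c = c') (hd : d = d')
    (h : a' + b' = A c' + A d') : a + b = A (c + d) := by
  rw [map_add, ha, hb, hc, hd, h]

/-- A common vector is a multiple of `α_i'` at a point and of `α_j'` at its mirror image, and the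
latter is also a multiple of `β_i'`. Transversality of `α_j` and `β_i` forces both multiples to
vanish. -/
theorem disjoint_torusTangent_fixedTangent {D : Diagram S m l h} {x : Sym S m}
    (T : D.TorusPoint x) (hx : x ∈ D.puncturedFixedLocus) :
    Disjoint (D.torusTangent x) (D.fixedTangent x) := by
  rw [Submodule.disjoint_def]
  intro v hv hv'
  funext p
  obtain ⟨i, rfl⟩ := T.equiv.surjective p
  obtain ⟨j, hj⟩ := T.mem_iff.1 (τ_mem hx (T.mem i))
  have hτ : D.τ (T.equiv i).1 ∈ x := τ_mem hx (T.mem i)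
  obtain ⟨a, ha⟩ := Submodule.mem_span_singleton.1 (hv i (T.t i) (T.mem i))
  obtain ⟨b, hb⟩ := Submodule.mem_span_singleton.1 (hv j (T.t j) (T.mem j))
  have h1 := hv' (T.equiv i) hτ
  have h2 : (v ⟨D.τ (T.equiv i).1, hτ⟩ : Plane) = v ⟨D.α j (T.t j), T.mem j⟩ := by
    have : (⟨D.α j (T.t j), T.mem j⟩ : {p : S // p ∈ x}) = ⟨D.τ (T.equiv i).1, hτ⟩ :=
      Subtype.ext hj
    rw [this]
  let A : Plane →L[ℝ] Plane := mfderiv (𝓡 2) (𝓡 2) D.τ (D.α i (T.t i))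
  have h3 : b • (velocity (D.α j) (T.t j) : Plane) = A (a • (velocity (D.α i) (T.t i) : Plane)) :=
    hb.trans (h2.symm.trans (h1.trans (congrArg A ha.symm)))
  have aux : ∀ u w : Plane, b • u = a • w → b • u + (-a) • w = 0 := fun u w h => by
    rw [neg_smul, h, add_neg_cancel]
  have hli := LinearIndependent.pair_iff.1 (D.linearIndependent_velocity hj.symm) b (-a)
    (aux _ _ (h3.trans (A.map_smul a _)))
  rw [neg_eq_zero.1 hli.2, zero_smul] at ha
  exact ha.symm

section Frame

variable {D : Diagram S m l h} {x : Sym S m} {k n : ℕ} {P : D.StratumPoint x k n}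

theorem frame_mem_fixedTangent (E : ∀ i, Basis (Fin 2) ℝ (TangentSpace (𝓡 2) (P.z i))) (a : Fin m) :
    P.frame E a ∈ D.fixedTangent x := by
  obtain ⟨a, rfl⟩ := P.index.surjective a
  rintro ⟨p, hp⟩ hp'
  let A : Plane →L[ℝ] Plane := mfderiv (𝓡 2) (𝓡 2) D.τ p
  rcases a with ⟨i, c⟩ | j
  · rw [P.frame_index_inl]
    let B : Plane →L[ℝ] Plane := mfderiv (𝓡 2) (𝓡 2) D.τ (P.z i)
    have hne : D.τ (P.z i) ≠ P.z i := (P.z_mem i).1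
    by_cases h1 : p = P.z i
    · subst h1
      refine add_eq_map_add A.toLinearMap
        (vecAt_of_ne x (P.z i) ⟨D.τ (P.z i), hp'⟩ hne (E i c))
        (vecAt_of_eq x (D.τ (P.z i)) ⟨D.τ (P.z i), hp'⟩ rfl (B (E i c)))
        (vecAt_of_eq x (P.z i) ⟨P.z i, hp⟩ rfl (E i c))
        (vecAt_of_ne x (D.τ (P.z i)) ⟨P.z i, hp⟩ hne.symm (B (E i c))) ?_
      refine (zero_add (A (E i c) : Plane)).trans (Eq.trans ?_
        (congrArg (fun w : Plane => (A (E i c) : Plane) + w) (map_zero A).symm))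
      exact (add_zero (A (E i c) : Plane)).symm
    · by_cases h2 : p = D.τ (P.z i)
      · subst h2
        refine add_eq_map_add A.toLinearMap
          (vecAt_of_eq x (P.z i) ⟨_, hp'⟩ (D.τ_invol _) (E i c))
          (vecAt_of_ne x (D.τ (P.z i)) ⟨_, hp'⟩ (D.τ_ne hne) (B (E i c)))
          (vecAt_of_ne x (P.z i) ⟨_, hp⟩ hne (E i c))
          (vecAt_of_eq x (D.τ (P.z i)) ⟨_, hp⟩ rfl (B (E i c))) ?_
        refine (add_zero (E i c : Plane)).trans (Eq.trans ?_
          (congrArg (fun w : Plane => w + (A (B (E i c)) : Plane)) (map_zero A).symm))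
        exact (D.mfderiv_τ_τ (P.z i) (E i c)).symm.trans (zero_add (A (B (E i c)) : Plane)).symm
      · have h3 : D.τ p ≠ P.z i := fun h => h2 (by rw [← h, D.τ_invol])
        have h4 : D.τ p ≠ D.τ (P.z i) := fun h => h1 (by rw [← D.τ_invol p, h, D.τ_invol])
        refine add_eq_map_add A.toLinearMap
          (vecAt_of_ne x (P.z i) ⟨_, hp'⟩ h3 (E i c)) (vecAt_of_ne x _ ⟨_, hp'⟩ h4 (B (E i c)))
          (vecAt_of_ne x (P.z i) ⟨_, hp⟩ h1 (E i c)) (vecAt_of_ne x _ ⟨_, hp⟩ h2 (B (E i c))) ?_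
        exact (congrArg₂ (fun v w : Plane => v + w) (map_zero A) (map_zero A)).symm
  · rw [P.frame_index_inr]
    have hc := D.τ_fix (P.comp j) (P.par j)
    by_cases h1 : p = D.fix (P.comp j) (P.par j)
    · subst h1
      refine (vecAt_of_eq x _ ⟨_, hp'⟩ hc _).trans ?_
      rw [vecAt_of_eq x _ ⟨_, hp⟩ rfl]
      exact (D.mfderiv_τ_velocity_fix _ _).symm
    · have h2 : D.τ p ≠ D.fix (P.comp j) (P.par j) := fun h => h1 (by rw [← D.τ_invol p, h, hc])
      refine (vecAt_of_ne x _ ⟨_, hp'⟩ h2 _).trans ?_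
      rw [vecAt_of_ne x _ ⟨_, hp⟩ h1]
      exact (map_zero A).symm

theorem vecAt_mem_torusTangent (T : D.TorusPoint x) (i : Fin m) :
    vecAt x (D.α i (T.t i)) (velocity (D.α i) (T.t i)) ∈ D.torusTangent x := by
  intro j t hp
  by_cases hij : j = i
  · subst hij
    have h1 := T.α_eq hp
    have h2 : (vecAt x (D.α j (T.t j)) (velocity (D.α j) (T.t j)) ⟨D.α j t, hp⟩ : Plane) =
        velocity (D.α j) t :=
      (vecAt_of_eq x _ ⟨_, hp⟩ h1.symm _).trans ((D.α_circle j).velocity_congr h1)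
    refine Submodule.mem_span_singleton.2 ⟨1, ?_⟩
    rw [one_smul]
    exact h2.symm
  · rw [vecAt_of_ne x _ ⟨_, hp⟩ fun h => hij (index_eq h)]
    exact Submodule.zero_mem _

variable (L : Labelling P) (T : D.TorusPoint x)

theorem Labelling.point_zero (i : Fin k) :
    (T.equiv (L.perm T (P.index (Sum.inl (i, 0))))).1 = P.z i := by
  rw [L.perm_index_zero]; exact L.point_r T i

theorem Labelling.point_one (i : Fin k) :
    (T.equiv (L.perm T (P.index (Sum.inl (i, 1))))).1 = D.τ (P.z i) := by
  rw [L.perm_index_one]; exact L.point_σ_r T i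

theorem Labelling.point_inr (j : Fin n) :
    (T.equiv (L.perm T (P.index (Sum.inr j)))).1 = D.fix (P.comp j) (P.par j) := by
  rw [L.perm_index_inr]; exact L.point_s T j

theorem Labelling.point_ne {a b : (Fin k × Fin 2) ⊕ Fin n} (hab : a ≠ b) :
    (T.equiv (L.perm T (P.index a))).1 ≠ (T.equiv (L.perm T (P.index b))).1 := fun h =>
  hab (P.index.injective ((L.perm T).injective (T.equiv.injective (Subtype.ext h))))

theorem Labelling.vecAt_point {a b : (Fin k × Fin 2) ⊕ Fin n} {q : S}
    (hq : (T.equiv (L.perm T (P.index b))).1 = q) (v : TangentSpace (𝓡 2) q) :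
    (vecAt x q v (T.equiv (L.perm T (P.index a))) : Plane) = if a = b then (v : Plane) else 0 := by
  split_ifs with hab
  · subst hab; exact vecAt_of_eq x q _ hq v
  · exact vecAt_of_ne x q _ (fun h => L.point_ne T hab (h.trans hq.symm)) v

variable (F : ∀ p : {p : S // p ∈ x}, Basis (Fin 2) ℝ (TangentSpace (𝓡 2) p.1))
  (E : ∀ i, Basis (Fin 2) ℝ (TangentSpace (𝓡 2) (P.z i)))

/-- The basis of the tangent plane at `z_i` that belongs to a choice of bases at all points. -/
def Labelling.basisZ (i : Fin k) : Basis (Fin 2) ℝ (TangentSpace (𝓡 2) (P.z i)) :=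
  (F (T.equiv (L.perm T (P.index (Sum.inl (i, 0))))) : Basis (Fin 2) ℝ Plane)

/-- A frame vector given by `v` at `z_i` has second coordinate `v_1` at `z_i` and `v_0` at `τ(z_i)`,
where the basis is the swapped image: the rows of the block appear exchanged, whence the minus sign.
At `c_j` the frame vector is the second basis vector itself. -/
theorem Labelling.det_frame (hF0 : ∀ i, F (T.equiv i) 0 = velocity (D.α i) (T.t i))
    (hF1 : ∀ a, (F (T.equiv (L.perm T (P.index a))) 1 : Plane) = L.transverseVec a) :
    ((Equiv.Perm.sign (L.perm T) : ℤ) : ℝ) *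
      (Matrix.of fun i j : Fin m => (F (T.equiv i)).repr (P.frame E j (T.equiv i)) 1).det =
      ∏ i, -(L.basisZ T F i).det (E i) := by
  -- This is the form required by `det_of_swapped_blocks`, with columns numbered by `P.index` and
  -- rows by the curves that the labelling attaches to them.
  have hperm : L.perm T = P.index.symm.trans (P.index.trans (L.perm T)) := by
    ext; simp
  have h0 : ∀ i, (L.basisZ T F i 0 : Plane) = velocity (D.α (L.r i)) (L.tα i) := by
    intro i
    refine (hF0 _).trans ?_
    rw [L.perm_index_zero, L.velocity_r]
  have h1 : ∀ i, (L.basisZ T F i 1 : Plane) = velocity (D.β (L.σ (L.r i))) (L.tβ i) := by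
    intro i
    exact hF1 (Sum.inl (i, 0))
  conv_lhs => rw [hperm]
  simp only [Basis.det_apply]
  let G : (Fin k × Fin 2) ⊕ Fin n → Basis (Fin 2) ℝ Plane := fun a =>
    F (T.equiv (L.perm T (P.index a)))
  let A : Fin k → Plane →L[ℝ] Plane := fun i => mfderiv (𝓡 2) (𝓡 2) D.τ (P.z i)
  let ev : Fin k → Fin 2 → Plane := fun i c => E i c
  let f : (Fin k × Fin 2) ⊕ Fin n → (Fin k × Fin 2) ⊕ Fin n → Plane := fun a b =>
    P.frame E (P.index b) (T.equiv (L.perm T (P.index a)))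
  have hswap : ∀ i (v : Plane), (G (Sum.inl (i, 1))).repr (A i v) 1 =
      (L.basisZ T F i).repr v 0 := by
    intro i v
    refine repr_one_of_swap (L.basisZ T F i : Basis (Fin 2) ℝ Plane) (G (Sum.inl (i, 1)))
      (A i).toLinearMap ?_ ?_ v
    · refine (congrArg (A i) (h0 i)).trans ((L.mfderiv_velocity_α i).trans ?_)
      exact (hF1 (Sum.inl (i, 1))).symm
    · refine (congrArg (A i) (h1 i)).trans ((L.mfderiv_velocity_β i).trans ?_)
      refine Eq.trans ?_ (hF0 _).symm
      rw [L.perm_index_one, L.velocity_σ_r]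
  have hf : ∀ a i c, f a (Sum.inl (i, c)) =
      (if a = Sum.inl (i, 0) then ev i c else 0) + if a = Sum.inl (i, 1) then A i (ev i c) else 0 := by
    intro a i c
    refine (congrFun (P.frame_index_inl E i c) _).trans ?_
    exact congrArg₂ (fun v w : Plane => v + w) (L.vecAt_point T (L.point_zero T i) _)
      (L.vecAt_point T (L.point_one T i) _)
  have hf' : ∀ a j, f a (Sum.inr j) = if a = Sum.inr j then G (Sum.inr j) 1 else 0 := by
    intro a j
    refine (congrFun (P.frame_index_inr E j) _).trans ?_
    refine (L.vecAt_point T (L.point_inr T j) _).trans ?_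
    refine if_congr Iff.rfl ?_ rfl
    exact (hF1 (Sum.inr j)).symm
  refine det_of_swapped_blocks _ _ _ _ ?_ ?_ ?_ ?_ ?_
  · intro i i' c
    change (G (Sum.inl (i, 0))).repr (f (Sum.inl (i, 0)) (Sum.inl (i', c))) 1 = _
    rw [hf]
    by_cases hi : i = i'
    · subst hi; simp [Basis.toMatrix_apply]; rfl
    · simp [hi]
  · intro i i' c
    change (G (Sum.inl (i, 1))).repr (f (Sum.inl (i, 1)) (Sum.inl (i', c))) 1 = _
    rw [hf]
    by_cases hi : i = i'
    · subst hi
      simp only [Sum.inl.injEq, Prod.mk.injEq, one_ne_zero, and_false, if_false,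
        if_true, zero_add, hswap]
      rfl
    · simp [hi]
  · intro i c j
    change (G (Sum.inl (i, c))).repr (f (Sum.inl (i, c)) (Sum.inr j)) 1 = _
    rw [hf']
    simp
  · intro j i c
    change (G (Sum.inr j)).repr (f (Sum.inr j) (Sum.inl (i, c))) 1 = _
    rw [hf]
    simp
  · intro j j'
    change (G (Sum.inr j)).repr (f (Sum.inr j) (Sum.inr j')) 1 = _
    rw [hf']
    by_cases hj : j = j'
    · subst hj; simp
    · simp [hj]

end Frame

end Diagram

/-! ### The sign for a fixed presentation. -/

namespace Diagram

variable {S : Type} [TopologicalSpace S] [ChartedSpace Plane S] {m l h : ℕ}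
  {D : Diagram S m l h} {x : Sym S m} {k n : ℕ} {P : D.StratumPoint x k n}

theorem localSign_eq_of_eq {o o' : OrientationField S} {p : S} (hp : o p = o' p)
    (u v : TangentSpace (𝓡 2) p) : localSign o p u v = localSign o' p u v :=
  localSign_eq_of_iff (by rw [PosPair, PosPair, hp]) (by rw [PosPair, PosPair, hp])

namespace Labelling

variable (L : Labelling P) (T : D.TorusPoint x)
  (F : ∀ p : {p : S // p ∈ x}, Basis (Fin 2) ℝ (TangentSpace (𝓡 2) p.1))

theorem localSign_basisZ (hF0 : ∀ i, F (T.equiv i) 0 = velocity (D.α i) (T.t i))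
    (hF1 : ∀ a, (F (T.equiv (L.perm T (P.index a))) 1 : Plane) = L.transverseVec a) (i : Fin k) :
    localSign D.oQuot (P.z i) (L.basisZ T F i 0) (L.basisZ T F i 1) = L.signZ i := by
  refine localSign_congr rfl ?_ (hF1 (Sum.inl (i, 0)))
  refine (hF0 _).trans ?_
  rw [L.perm_index_zero, L.velocity_r]

theorem localSign_zero (hF0 : ∀ i, F (T.equiv i) 0 = velocity (D.α i) (T.t i))
    (hF1 : ∀ a, (F (T.equiv (L.perm T (P.index a))) 1 : Plane) = L.transverseVec a) (i : Fin k) :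
    localSign D.o (T.equiv (L.perm T (P.index (Sum.inl (i, 0))))).1
      (F (T.equiv (L.perm T (P.index (Sum.inl (i, 0))))) 0)
      (F (T.equiv (L.perm T (P.index (Sum.inl (i, 0))))) 1) = L.signZ i := by
  rw [← L.localSign_basisZ T F hF0 hF1 i, localSign_eq_of_eq (P.z_mem i).2]
  exact localSign_congr (L.point_zero T i) rfl rfl

/-- The basis at `τ(z_i)` is the mirror image of the one at `z_i` with its vectors exchanged, so
`localSign_τ` applies. -/
theorem localSign_one (hF0 : ∀ i, F (T.equiv i) 0 = velocity (D.α i) (T.t i))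
    (hF1 : ∀ a, (F (T.equiv (L.perm T (P.index a))) 1 : Plane) = L.transverseVec a) (i : Fin k) :
    localSign D.o (T.equiv (L.perm T (P.index (Sum.inl (i, 1))))).1
      (F (T.equiv (L.perm T (P.index (Sum.inl (i, 1))))) 0)
      (F (T.equiv (L.perm T (P.index (Sum.inl (i, 1))))) 1) = L.signZ i := by
  have h1 : L.signZ i = localSign D.o (P.z i) (velocity (D.α (L.r i)) (L.tα i) : Plane)
      (velocity (D.β (L.σ (L.r i))) (L.tβ i) : Plane) :=
    localSign_eq_of_eq (P.z_mem i).2 _ _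
  refine Eq.trans ?_ ((D.localSign_τ (P.z i) _ _).trans h1.symm)
  refine localSign_congr (L.point_one T i) ?_ ?_
  · refine (hF0 _).trans ?_
    rw [L.perm_index_one, L.velocity_σ_r]
    exact (L.mfderiv_velocity_β i).symm
  · refine (hF1 (Sum.inl (i, 1))).trans ?_
    exact (L.mfderiv_velocity_α i).symm

theorem localSign_inr (hF0 : ∀ i, F (T.equiv i) 0 = velocity (D.α i) (T.t i))
    (hF1 : ∀ a, (F (T.equiv (L.perm T (P.index a))) 1 : Plane) = L.transverseVec a) (j : Fin n) :
    localSign D.o (T.equiv (L.perm T (P.index (Sum.inr j)))).1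
      (F (T.equiv (L.perm T (P.index (Sum.inr j)))) 0)
      (F (T.equiv (L.perm T (P.index (Sum.inr j)))) 1) = L.signC j := by
  refine localSign_congr (L.point_inr T j) ?_ (hF1 (Sum.inr j))
  refine (hF0 _).trans ?_
  rw [L.perm_index_inr, L.velocity_s]

/-- The equal signs at `z_i` and `τ(z_i)` multiply to `1`. -/
theorem prod_localSign (hF0 : ∀ i, F (T.equiv i) 0 = velocity (D.α i) (T.t i))
    (hF1 : ∀ a, (F (T.equiv (L.perm T (P.index a))) 1 : Plane) = L.transverseVec a)
    (hZ : ∀ i, L.signZ i * L.signZ i = 1) :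
    ∏ i, localSign D.o (T.equiv i).1 (F (T.equiv i) 0) (F (T.equiv i) 1) = ∏ j, L.signC j := by
  rw [← (P.index.trans (L.perm T)).prod_comp, Fintype.prod_sum_type, Fintype.prod_prod_type]
  simp only [Fin.prod_univ_two, Equiv.trans_apply]
  refine (congrArg₂ (· * ·) (Finset.prod_eq_one fun i _ => ?_)
    (Finset.prod_congr rfl fun j _ => L.localSign_inr T F hF0 hF1 j)).trans (one_mul _)
  exact (congrArg₂ (· * ·) (L.localSign_zero T F hF0 hF1 i)
    (L.localSign_one T F hF0 hF1 i)).trans (hZ i)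

end Labelling

/-- The velocities of the alpha curves, as tangent vectors to the symmetric product. -/
def TorusPoint.vec (T : D.TorusPoint x) (i : Fin m) : SymTangent x :=
  vecAt x (D.α i (T.t i)) (velocity (D.α i) (T.t i))

theorem Labelling.splitBasis_det_eq (L : Labelling P) (T : D.TorusPoint x)
    (F : ∀ p : {p : S // p ∈ x}, Basis (Fin 2) ℝ (TangentSpace (𝓡 2) p.1))
    (E : ∀ i, Basis (Fin 2) ℝ (TangentSpace (𝓡 2) (P.z i)))
    (hF0 : ∀ i, F (T.equiv i) 0 = velocity (D.α i) (T.t i))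
    (hF1 : ∀ a, (F (T.equiv (L.perm T (P.index a))) 1 : Plane) = L.transverseVec a) :
    ((Equiv.Perm.sign (L.perm T) : ℤ) : ℝ) *
      (splitBasis x T.equiv F).det (Fin.append T.vec (P.frame E)) =
      ∏ i, -(L.basisZ T F i).det (E i) := by
  rw [← L.det_frame T F E hF0 hF1, splitBasis_det]
  · simp only [Fin.append_right]
  · intro i
    rw [Fin.append_left, hF0]
    rfl

theorem Labelling.isCompl_and_bases (L : Labelling P) (T : D.TorusPoint x)
    (hx : x ∈ D.puncturedFixedLocus)
    (E : ∀ i, Basis (Fin 2) ℝ (TangentSpace (𝓡 2) (P.z i))) :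
    IsCompl (D.torusTangent x) (D.fixedTangent x) ∧
      (∃ b : Basis (Fin m) ℝ (D.torusTangent x), ∀ i, (b i : SymTangent x) = T.vec i) ∧
      ∃ b : Basis (Fin m) ℝ (D.fixedTangent x), ∀ a, (b a : SymTangent x) = P.frame E a := by
  obtain ⟨F, hF0, hF1⟩ := L.exists_adapted_bases T
  have hdet : (splitBasis x T.equiv F).det (Fin.append T.vec (P.frame E)) ≠ 0 := by
    have h1 := L.splitBasis_det_eq T F E hF0 hF1
    have h2 : ∏ i, -(L.basisZ T F i).det (E i) ≠ 0 := Finset.prod_ne_zero_iff.2 fun i _ =>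
      neg_ne_zero.2 ((L.basisZ T F i).isUnit_det (E i)).ne_zero
    exact right_ne_zero_of_mul (h1 ▸ h2)
  obtain ⟨h1, h2⟩ := (Module.Basis.is_basis_iff_det (splitBasis x T.equiv F)).2 hdet.isUnit
  exact isCompl_of_basis_append (disjoint_torusTangent_fixedTangent T hx)
    (vecAt_mem_torusTangent T) (frame_mem_fixedTangent E) h1 h2

/-- With $p=h+l-1$ the exponent $h+l-k-1$ of the orientation convention is the natural number $p-k$.
-/
theorem StratumPoint.half_card (P : D.StratumPoint x k n) :
    ∃ p : ℕ, m = 2 * p ∧ p + 1 = h + l ∧ k ≤ p := by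
  have h1 := D.card_alpha
  have h2 := D.fix_nonempty
  have h3 := P.card_eq
  exact ⟨h + (l - 1), by omega, by omega, by omega⟩

theorem TorusPoint.basis_eq (T : D.TorusPoint x) {b : Basis (Fin m) ℝ (D.torusTangent x)}
    (hb : ∀ i, ∃ t, D.α i t ∈ x ∧
      (b i : SymTangent x) = vecAt x (D.α i t) (velocity (D.α i) t)) (i : Fin m) :
    (b i : SymTangent x) = T.vec i := by
  obtain ⟨t, ht, h1⟩ := hb i
  rw [h1]
  exact vecAt_congr x (T.α_eq ht).symm _ _ ((D.α_circle i).velocity_congr (T.α_eq ht).symm)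

/-- The determinant is factored through the adapted basis in point order, the same basis split into
halves, and the juxtaposition of the reference frames `u₀` and `b₀`. -/
theorem Labelling.hasSign_det (L : Labelling P) (T : D.TorusPoint x)
    (hc : IsCompl (D.torusTangent x) (D.fixedTangent x))
    {u : Basis (Fin m) ℝ (D.torusTangent x)} (hu : D.IsPosTorus x u)
    {w : Basis (Fin (m + m)) ℝ (SymTangent x)} (hw : D.IsPosSym x w)
    {E : ∀ i, Basis (Fin 2) ℝ (TangentSpace (𝓡 2) (P.z i))}
    (hE : ∀ i, (E i).orientation = D.oQuot (P.z i))
    {v b₀ : Basis (Fin m) ℝ (D.fixedTangent x)} (hb₀ : ∀ a, (b₀ a : SymTangent x) = P.frame E a)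
    (hv : v.orientation = Int.negOnePow ((h : ℤ) + l - k - 1) • b₀.orientation) :
    HasSign (w.det (appendBasis hc u v))
      ((Equiv.Perm.sign (L.perm T) : ℤ) * (∏ i, L.signZ i) * ∏ j, L.signC j) := by
  obtain ⟨u₀, hu₀, hu⟩ := hu
  obtain ⟨F, hF0, hF1⟩ := L.exists_adapted_bases T
  obtain ⟨p, hm, hp, hk⟩ := P.half_card
  have hZ : ∀ i, HasSign ((L.basisZ T F i).det (E i)) (L.signZ i) := by
    intro i
    rw [← L.localSign_basisZ T F hF0 hF1 i]
    exact (hasSign_localSign (hE i)).det_symm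
  have h1 := hw.hasSign T.equiv F
  rw [L.prod_localSign T F hF0 hF1 fun i => (hZ i).mul_self] at h1
  have h2 : HasSign ((symBasis x T.equiv F).det (splitBasis x T.equiv F)) ((-1) ^ p) := by
    rw [symBasis_det_splitBasis x T.equiv F hm]
    simpa using HasSign.units ((-1) ^ p)
  have h3 : HasSign ((splitBasis x T.equiv F).det (appendBasis hc u₀ b₀))
      ((Equiv.Perm.sign (L.perm T) : ℤ) * ∏ i, -L.signZ i) := by
    have hfun : ⇑(appendBasis hc u₀ b₀) = Fin.append T.vec (P.frame E) := by
      funext a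
      rw [appendBasis_apply]
      congr 1
      · exact funext (T.basis_eq hu₀)
      · exact funext hb₀
    have h4 := (HasSign.units (Equiv.Perm.sign (L.perm T))).mul
      (HasSign.prod fun i => (hZ i).neg)
    rw [← L.splitBasis_det_eq T F E hF0 hF1, ← mul_assoc] at h4
    -- The sign of the permutation is its own inverse, so it passes to the other side.
    have h5 : ((Equiv.Perm.sign (L.perm T) : ℤ) : ℝ) * ((Equiv.Perm.sign (L.perm T) : ℤ) : ℝ) = 1 := by
      rcases Int.units_eq_one_or (Equiv.Perm.sign (L.perm T)) with h | h <;> rw [h] <;> simp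
    rwa [h5, one_mul, ← hfun] at h4
  have h4 : HasSign ((appendBasis hc u₀ b₀).det (appendBasis hc u v)) ((-1) ^ (p - k)) := by
    rw [appendBasis_det]
    have h5 := (HasSign.one_iff.2 ((Basis.orientation_eq_iff_det_pos u₀ u).1 hu.symm)).mul
      (hasSign_det_of_orientation _ hv)
    have h6 : (h : ℤ) + l - k - 1 = ((p - k : ℕ) : ℤ) := by omega
    rwa [h6, one_mul, Int.coe_negOnePow_natCast] at h5
  have h5 := ((h1.mul h2).mul h3).mul h4
  rw [Basis.det_mul_det, Basis.det_mul_det, Basis.det_mul_det] at h5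
  convert h5 using 1
  -- The three factors come from the shuffle, from the exchanged rows of the `k` blocks, and from
  -- the orientation convention.
  have h6 : ((-1 : ℤ) ^ p) * (-1) ^ k * (-1) ^ (p - k) = 1 := by
    rw [mul_assoc, ← pow_add, Nat.add_sub_cancel' hk, ← mul_pow]; simp
  have h7 : ∏ i, -L.signZ i = (-1) ^ k * ∏ i, L.signZ i := by
    rw [Finset.prod_neg]; simp
  rw [h7]
  linear_combination (-(Equiv.Perm.sign (L.perm T) : ℤ) * (∏ i, L.signZ i) * ∏ j, L.signC j) * h6

theorem Labelling.exists_isPosFixed (L : Labelling P) (T : D.TorusPoint x)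
    (hx : x ∈ D.puncturedFixedLocus) : ∃ v, D.IsPosFixed x v := by
  choose E hE using fun i => exists_basis_orientation (D.oQuot (P.z i))
  obtain ⟨-, -, b₀, hb₀⟩ := L.isCompl_and_bases T hx E
  obtain ⟨p, hm, hp, hk⟩ := P.half_card
  -- An orientation can be adjusted only over a nonempty index set. For `m = 0` also `p = k = 0`,
  -- and the prescribed sign is trivial.
  rcases Nat.eq_zero_or_pos m with h0 | h0
  · refine ⟨b₀, k, n, P, E, b₀, hE, hb₀, ?_⟩
    have h1 : (h : ℤ) + l - k - 1 = 0 := by omega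
    rw [h1, Int.negOnePow_zero, one_smul]
  · have : Nonempty (Fin m) := ⟨⟨0, h0⟩⟩
    exact ⟨b₀.adjustToOrientation _, k, n, P, E, b₀, hE, hb₀,
      b₀.orientation_adjustToOrientation _⟩

end Diagram


/-! ### Independence of the presentation, and existence of a labelling. -/

namespace Diagram

variable {S : Type} [TopologicalSpace S] [ChartedSpace Plane S] {m l h : ℕ}
  {D : Diagram S m l h} {x : Sym S m}

theorem notMem_plusPart_fix (i : Fin l) (t : ℝ) : D.fix i t ∉ D.plusPart :=
  fun hp => hp.1 (D.τ_fix i t)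

theorem toLex_eq_of_fix_eq {i j : Fin l} {s t : ℝ} (hs : s ∈ Ioo (0 : ℝ) 1)
    (ht : t ∈ Ioo (0 : ℝ) 1) (hst : D.fix i s = D.fix j t) : toLex (i, s) = toLex (j, t) := by
  have hij : i = j := by
    by_contra hij
    exact Set.disjoint_left.1 (D.fix_disjoint i j hij) ⟨s, rfl⟩ ⟨t, hst.symm⟩
  subst hij
  rw [(D.fix_circle i).injOn (Ioo_subset_Ico_self hs) (Ioo_subset_Ico_self ht) hst]

theorem velocity_fix_congr {i j : Fin l} {s t : ℝ} (hij : i = j) (hst : s = t) :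
    (velocity (D.fix i) s : Plane) = velocity (D.fix j) t := by
  subst hij hst; rfl

namespace StratumPoint

theorem z_injective {k n : ℕ} (P : D.StratumPoint x k n) (T : D.TorusPoint x) :
    Function.Injective P.z := by
  have h1 := T.nodup
  rw [P.eq] at h1
  have h2 := (Multiset.nodup_add.1 (Multiset.nodup_add.1 h1).1).1
  intro i j hij
  exact Multiset.inj_on_of_nodup_map h2 i (Finset.mem_univ i) j (Finset.mem_univ j) hij

theorem range_z {k n : ℕ} (P : D.StratumPoint x k n) : range P.z = {p | p ∈ x ∧ p ∈ D.plusPart} := by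
  ext p
  constructor
  · rintro ⟨i, rfl⟩
    exact ⟨P.z_mem_sym i, P.z_mem i⟩
  · rintro ⟨hp, hp'⟩
    rcases P.mem_iff.1 hp with h1 | ⟨i, rfl⟩ | ⟨j, rfl⟩
    · exact h1
    · exact absurd hp' (D.notMem_plusPart_τ (P.z_mem i))
    · exact absurd hp' (notMem_plusPart_fix _ _)

theorem range_toLex_subset {k n k' n' : ℕ} (P : D.StratumPoint x k n)
    (P' : D.StratumPoint x k' n') :
    range (fun j => toLex (P.comp j, P.par j)) ⊆ range fun j => toLex (P'.comp j, P'.par j) := by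
  rintro _ ⟨j, rfl⟩
  have hfix := D.τ_fix (P.comp j) (P.par j)
  rcases P'.mem_iff.1 (P.c_mem_sym j) with ⟨i, hi⟩ | ⟨i, hi⟩ | ⟨j', hj⟩
  · rw [← hi] at hfix; exact absurd hfix (P'.z_mem i).1
  · rw [← hi] at hfix; exact absurd hfix (D.τ_ne (P'.z_mem i).1)
  · exact ⟨j', toLex_eq_of_fix_eq (P'.par_mem j') (P.par_mem j) hj⟩

/-- The two presentations of a configuration differ by a permutation of the points `z_i`. -/
theorem exists_perm_of_two {k n : ℕ} (P P' : D.StratumPoint x k n) (T : D.TorusPoint x) :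
    ∃ ρ : Equiv.Perm (Fin k), (∀ i, P.z (ρ i) = P'.z i) ∧ P.comp = P'.comp ∧ P.par = P'.par := by
  refine ⟨(Equiv.ofInjective _ (P'.z_injective T)).trans
    ((Equiv.setCongr (P'.range_z.trans P.range_z.symm)).trans
      (Equiv.ofInjective _ (P.z_injective T)).symm), fun i => ?_, ?_⟩
  · simp only [Equiv.trans_apply]
    rw [Equiv.apply_ofInjective_symm (P.z_injective T)]
    rfl
  · have h1 := (StrictMono.range_inj P.ordered P'.ordered).1
      ((P.range_toLex_subset P').antisymm (P'.range_toLex_subset P))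
    have h2 : ∀ j, P.comp j = P'.comp j ∧ P.par j = P'.par j := fun j =>
      Prod.mk.inj (toLex.injective (congrFun h1 j))
    exact ⟨funext fun j => (h2 j).1, funext fun j => (h2 j).2⟩

theorem card_eq_card {k n k' n' : ℕ} (P : D.StratumPoint x k n) (P' : D.StratumPoint x k' n')
    (T : D.TorusPoint x) : k = k' ∧ n = n' := by
  have h1 : k = k' := by
    simpa using Fintype.card_congr ((Equiv.ofInjective _ (P.z_injective T)).trans
      ((Equiv.setCongr (P.range_z.trans P'.range_z.symm)).trans
        (Equiv.ofInjective _ (P'.z_injective T)).symm))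
  have h2 := P.card_eq
  have h3 := P'.card_eq
  exact ⟨h1, by omega⟩

end StratumPoint

/-- `IsPosFixed` may be witnessed by any presentation of `x`. Passing to another one permutes the
`z_i`, hence the pairs `(r(i), σ(r(i)))`; this is an even permutation of the list, and it merely
reorders the factors `ε(z_i)`. -/
theorem Labelling.exists_transfer {k n : ℕ} {P : D.StratumPoint x k n} (L : Labelling P)
    (P' : D.StratumPoint x k n) (T : D.TorusPoint x) :
    ∃ L' : Labelling P', Equiv.Perm.sign (L'.perm T) = Equiv.Perm.sign (L.perm T) ∧
      ∏ i, L'.signZ i = ∏ i, L.signZ i ∧ ∏ j, L'.signC j = ∏ j, L.signC j := by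
  obtain ⟨ρ, hz, hcomp, hpar⟩ := P.exists_perm_of_two P' T
  let L' : Labelling P' :=
    { σ := L.σ
      r := L.r ∘ ρ
      s := L.s
      σ_invol := L.σ_invol
      σ_fixed := L.σ_fixed
      r_injective := L.r_injective.comp ρ.injective
      s_injective := L.s_injective
      tα := L.tα ∘ ρ
      tβ := L.tβ ∘ ρ
      tc := L.tc
      z_mem_α := fun i => (L.z_mem_α (ρ i)).trans (hz i)
      z_mem_β := fun i => (L.z_mem_β (ρ i)).trans (hz i)
      c_mem_α := fun j => by rw [L.c_mem_α, hcomp, hpar] }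
  refine ⟨L', ?_, ?_, ?_⟩
  · let κ : Equiv.Perm ((Fin k × Fin 2) ⊕ Fin n) :=
      Equiv.sumCongr (Equiv.prodCongrLeft fun _ : Fin 2 => ρ) (Equiv.refl _)
    have h1 : L'.perm T = (P'.index.permCongr κ).trans (L.perm T) := by
      ext a
      obtain ⟨a, rfl⟩ := P'.index.surjective a
      simp only [Equiv.trans_apply, Equiv.permCongr_apply, Equiv.symm_apply_apply]
      rcases a with ⟨i, c⟩ | j
      · change _ = ((L.perm T) (P.index (Sum.inl (ρ i, c))) : ℕ)
        fin_cases c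
        · exact congrArg Fin.val ((L'.perm_index_zero T i).trans (L.perm_index_zero T (ρ i)).symm)
        · exact congrArg Fin.val ((L'.perm_index_one T i).trans (L.perm_index_one T (ρ i)).symm)
      · change _ = ((L.perm T) (P.index (Sum.inr j)) : ℕ)
        exact congrArg Fin.val ((L'.perm_index_inr T j).trans (L.perm_index_inr T j).symm)
    have h3 : Equiv.Perm.sign κ = 1 := by
      change Equiv.Perm.sign (Equiv.Perm.sumCongr (Equiv.prodCongrLeft fun _ : Fin 2 => ρ) 1) = 1
      rw [Equiv.Perm.sign_sumCongr, Equiv.Perm.sign_prodCongrLeft]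
      simp
    rw [h1, Equiv.Perm.sign_trans, Equiv.Perm.sign_permCongr, h3, mul_one]
  · rw [← Equiv.prod_comp ρ fun i => L.signZ i]
    exact Finset.prod_congr rfl fun i _ => localSign_congr (hz i).symm rfl rfl
  · refine Finset.prod_congr rfl fun j _ => localSign_congr (by rw [hcomp, hpar]) rfl ?_
    exact velocity_fix_congr (congrFun hcomp j).symm (congrFun hpar j).symm

theorem Labelling.hasIntersectionSign {k n : ℕ} {P : D.StratumPoint x k n} (L : Labelling P)
    (T : D.TorusPoint x) (hx : x ∈ D.puncturedFixedLocus) :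
    D.HasIntersectionSign x
      ((Equiv.Perm.sign (L.perm T) : ℤ) * (∏ i, L.signZ i) * ∏ j, L.signC j) := by
  choose E hE using fun i => exists_basis_orientation (D.oQuot (P.z i))
  obtain ⟨hc, ⟨u₀, hu₀⟩, -⟩ := L.isCompl_and_bases T hx E
  refine ⟨hc, ⟨u₀, u₀, fun i => ⟨T.t i, T.mem i, hu₀ i⟩, rfl⟩, L.exists_isPosFixed T hx,
    exists_isPosSym T.equiv, fun u v w b hu hv hw hb => ?_⟩
  obtain ⟨k', n', P', E', b₀, hE', hb₀, hv⟩ := hv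
  obtain ⟨rfl, rfl⟩ := P.card_eq_card P' T
  obtain ⟨L', hs, hZ, hC⟩ := L.exists_transfer P' T
  have hb' : b = appendBasis hc u v :=
    Basis.eq_of_apply_eq fun a => by rw [hb, appendBasis_apply]
  rw [← hs, ← hZ, ← hC, hb']
  exact orientation_smul_eq_of_hasSign (L'.hasSign_det T hc hu hw hE' hb₀ hv)

theorem TorusPoint.exists_fix_eq (T : D.TorusPoint x) (hx : x ∈ D.puncturedFixedLocus) {i : Fin m}
    (hi : D.τ (D.α i (T.t i)) = D.α i (T.t i)) :
    ∃ q : Fin l ×ₗ ℝ, (ofLex q).2 ∈ Ioo (0 : ℝ) 1 ∧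
      D.fix (ofLex q).1 (ofLex q).2 = D.α i (T.t i) := by
  have h1 : D.α i (T.t i) ∈ {p | D.τ p = p} := hi
  rw [D.fix_union] at h1
  obtain ⟨c, v, hv⟩ := mem_iUnion.1 h1
  -- The fractional part is not `0`, since the configuration contains no basepoint.
  refine ⟨toLex (c, Int.fract v), ⟨?_, Int.fract_lt_one v⟩, ?_⟩
  · refine (Int.fract_nonneg v).lt_of_ne fun h0 => hx.2 c ?_
    have h0' : Int.fract v = 0 := h0.symm
    rw [← h0', (D.fix_circle c).apply_fract, hv]
    exact T.mem i
  · exact ((D.fix_circle c).apply_fract v).trans hv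

/-- Each alpha curve carries one point of `x` and `τ` permutes these points, which induces the
involution of the indices. Its fixed points lie on `C` and are sorted lexicographically by component
and parameter; $\Sigma^+$ selects one index from each 2-cycle. -/
theorem TorusPoint.exists_labelling (T : D.TorusPoint x) (hx : x ∈ D.puncturedFixedLocus) :
    ∃ (k n : ℕ) (P : D.StratumPoint x k n), Nonempty (Labelling P) := by
  classical
  let p : Fin m → S := fun i => D.α i (T.t i)
  have hp : Function.Injective p := fun _ _ hij => index_eq hij
  choose f hf using fun i => T.mem_iff.1 (τ_mem hx (T.mem i))
  replace hf : ∀ i, p (f i) = D.τ (p i) := hf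
  have hff : Function.Involutive f := fun i => hp (by rw [hf, hf, D.τ_invol])
  have hfix : ∀ i, f i = i ↔ D.τ (p i) = p i := fun i => by rw [← hf, hp.eq_iff]
  have hq : ∀ i, ∃ q : Fin l ×ₗ ℝ, f i = i → (ofLex q).2 ∈ Ioo (0 : ℝ) 1 ∧
      D.fix (ofLex q).1 (ofLex q).2 = p i := fun i => by
    by_cases hi : f i = i
    · obtain ⟨q, hq⟩ := T.exists_fix_eq hx ((hfix i).1 hi)
      exact ⟨q, fun _ => hq⟩
    -- An arbitrary value at the indices that `f` moves.
    · exact ⟨toLex (⟨0, D.fix_nonempty⟩, 0), fun h => absurd h hi⟩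
  choose q hq using hq
  let R : Finset (Fin m) := Finset.univ.filter fun i => p i ∈ D.plusPart
  let Q : Finset (Fin l ×ₗ ℝ) := (Finset.univ.filter fun i => f i = i).image q
  let r := R.orderEmbOfFin rfl
  let o := Q.orderEmbOfFin rfl
  have hr : ∀ i, p (r i) ∈ D.plusPart := fun i =>
    (Finset.mem_filter.1 (R.orderEmbOfFin_mem rfl i)).2
  have hr' : ∀ i, p i ∈ D.plusPart → ∃ a, r a = i := fun i hi => by
    have : i ∈ Set.range r := by
      rw [Finset.range_orderEmbOfFin]; exact Finset.mem_filter.2 ⟨Finset.mem_univ _, hi⟩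
    exact this
  have hs : ∀ j, ∃ i, f i = i ∧ q i = o j := fun j => by
    obtain ⟨i, hi, hij⟩ := Finset.mem_image.1 (Q.orderEmbOfFin_mem rfl j)
    exact ⟨i, (Finset.mem_filter.1 hi).2, hij⟩
  choose s hs hsq using hs
  have hqinj : ∀ i j, f i = i → f j = j → q i = q j → i = j := fun i j hi hj hij =>
    hp (by rw [← (hq i hi).2, ← (hq j hj).2, hij])
  have hs' : ∀ i, f i = i → ∃ j, s j = i := fun i hi => by
    have : q i ∈ Set.range o := by
      rw [Finset.range_orderEmbOfFin]
      exact Finset.mem_image.2 ⟨i, Finset.mem_filter.2 ⟨Finset.mem_univ _, hi⟩, rfl⟩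
    obtain ⟨j, hj⟩ := this
    exact ⟨j, hqinj _ _ (hs j) hi ((hsq j).trans hj)⟩
  have hsinj : Function.Injective s := fun i j hij => o.injective (by rw [← hsq, ← hsq, hij])
  have hc : ∀ j, D.fix (ofLex (o j)).1 (ofLex (o j)).2 = p (s j) := fun j => by
    rw [← (hq (s j) (hs j)).2, hsq]
  have heq : (x : Multiset S) = Finset.univ.val.map (fun i => p (r i)) +
      (Finset.univ.val.map fun i => D.τ (p (r i))) + Finset.univ.val.map fun j => p (s j) := by
    -- Both multisets are free of repetitions, so it suffices to compare members.
    refine (Multiset.Nodup.ext T.nodup ?_).2 fun y => ?_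
    · have hτ : Function.Injective D.τ := Function.Involutive.injective D.τ_invol
      refine Multiset.nodup_add.2 ⟨Multiset.nodup_add.2
        ⟨Finset.univ.nodup.map (hp.comp r.injective),
          Finset.univ.nodup.map (hτ.comp (hp.comp r.injective)), ?_⟩,
        Finset.univ.nodup.map (hp.comp hsinj), ?_⟩
      · rw [Multiset.disjoint_left]
        intro y hy hy'
        obtain ⟨i, -, rfl⟩ := Multiset.mem_map.1 hy
        obtain ⟨j, -, hj⟩ := Multiset.mem_map.1 hy'
        exact D.notMem_plusPart_τ (hr j) (by rw [hj]; exact hr i)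
      · rw [Multiset.disjoint_right]
        intro y hy hy'
        obtain ⟨j, -, rfl⟩ := Multiset.mem_map.1 hy
        have hj := (hfix _).1 (hs j)
        rcases Multiset.mem_add.1 hy' with hy' | hy' <;> obtain ⟨i, -, hi⟩ := Multiset.mem_map.1 hy'
        · rw [← hi] at hj; exact (hr i).1 hj
        · rw [← hi] at hj; exact D.τ_ne (hr i).1 hj
    · rw [Sym.mem_coe, T.mem_iff]
      simp only [Multiset.mem_add, Multiset.mem_map, Finset.mem_val, Finset.mem_univ, true_and]
      constructor
      · rintro ⟨i, rfl⟩
        by_cases hi : f i = i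
        · obtain ⟨j, rfl⟩ := hs' i hi
          exact Or.inr ⟨j, rfl⟩
        · rcases D.mem_plusPart_or (mt (hfix i).2 hi) with h1 | h1
          · obtain ⟨a, rfl⟩ := hr' i h1
            exact Or.inl (Or.inl ⟨a, rfl⟩)
          · obtain ⟨a, ha⟩ := hr' (f i) (by rw [hf]; exact h1)
            exact Or.inl (Or.inr ⟨a, by rw [ha, hf, D.τ_invol]⟩)
      · rintro ((⟨i, rfl⟩ | ⟨i, rfl⟩) | ⟨j, rfl⟩)
        · exact ⟨r i, rfl⟩
        · exact ⟨f (r i), hf (r i)⟩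
        · exact ⟨s j, rfl⟩
  let P : D.StratumPoint x R.card Q.card :=
    { card_eq := by
        have h1 := congrArg Multiset.card heq
        rw [Sym.card_coe] at h1
        simp only [Multiset.card_add, Multiset.card_map, Finset.card_val, Finset.card_univ,
          Fintype.card_fin] at h1
        omega
      z := fun i => p (r i)
      comp := fun j => (ofLex (o j)).1
      par := fun j => (ofLex (o j)).2
      z_mem := hr
      par_mem := fun j => by
        have := (hq (s j) (hs j)).1
        rwa [hsq] at this
      ordered := o.strictMono
      eq := by simp only [hc]; exact heq }
  refine ⟨R.card, Q.card, P, ⟨?_⟩⟩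
  exact
    { σ := hff.toPerm f
      r := r
      s := s
      σ_invol := hff
      σ_fixed := fun i => ⟨hs' i, by rintro ⟨j, rfl⟩; exact hs j⟩
      r_injective := r.injective
      s_injective := hsinj
      tα := fun i => T.t (r i)
      tβ := fun i => T.t (f (r i))
      tc := fun j => T.t (s j)
      z_mem_α := fun i => rfl
      z_mem_β := fun i => by
        change D.τ (p (f (r i))) = p (r i)
        rw [hf, D.τ_invol]
      c_mem_α := fun j => (hc j).symm }

end Diagram

end RealHF

end

theorem mainTheorem10 {S : Type} [TopologicalSpace S] [T2Space S] [CompactSpace S]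
    [ConnectedSpace S] [ChartedSpace RealHF.Plane S] [IsManifold (𝓡 2) ∞ S] {m l h : ℕ}
    (D : RealHF.Diagram S m l h) (x : Sym S m) (hx : x ∈ D.torus ∩ D.puncturedFixedLocus) :
    (∃ (k n : ℕ) (P : D.StratumPoint x k n), Nonempty (RealHF.Diagram.Labelling P)) ∧
    ∀ (k n : ℕ) (P : D.StratumPoint x k n) (L : RealHF.Diagram.Labelling P),
      ∃ π : Equiv.Perm (Fin m), (∀ a, π a = L.list a) ∧
        D.HasIntersectionSign x
          ((Equiv.Perm.sign π : ℤ) * (∏ i, L.signZ i) * ∏ j, L.signC j) := by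
  obtain ⟨T⟩ := RealHF.Diagram.exists_torusPoint hx.1
  exact ⟨T.exists_labelling hx.2, fun k n P L =>
    ⟨L.perm T, fun _ => rfl, L.hasIntersectionSign T hx.2⟩⟩
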